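/- Let $K$ be a field, $a,b\in\mathbb Z$, and let $(\mathcal A,\cdot,[\ ,\ ],d)$ be a differential graded $(a,b)$-algebra over $K$: $\mathcal A=\bigoplus_{i\in\mathbb Z}\mathcal A_i$ is a graded $K$-vector space with bilinear operations $\cdot$ of degree $a$ and $[\ ,\ ]$ of degree $b$ and a linear map $d$ of degree $1$ such that, for all homogeneous $\alpha,\beta,\gamma$ of degrees $|\alpha|,|\beta|,|\gamma|$, $$\alpha\cdot\beta=(-1)^{(|\alpha|+a)(|\beta|+a)}\beta\cdot\alpha,\qquad \alpha\cdot(\beta\cdot\gamma)=(\alpha\cdot\beta)\cdot\gamma,\qquad [\alpha,\beta]=-(-1)^{(|\alpha|+b)(|\beta|+b)}[\beta,\alpha],$$ $$(-1)^{(|\alpha|+b)(|\gamma|+b)}[[\alpha,\beta],\gamma]+(-1)^{(|\beta|+b)(|\alpha|+b)}[[\beta,\gamma],\alpha]+(-1)^{(|\gamma|+b)(|\beta|+b)}[[\gamma,\alpha],\beta]=0,$$ $$[\alpha,\beta\cdot\gamma]=[\alpha,\beta]\cdot\gamma+(-1)^{(|\beta|+a)(|\alpha|+b)}\beta\cdot[\alpha,\gamma],\qquad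 d\circ d=0,$$ $$d(\alpha\cdot\beta)=d\alpha\cdot\beta+(-1)^{|\alpha|+a}\alpha\cdot d\beta,\qquad d([\alpha,\beta])=[d\alpha,\beta]+(-1)^{|\alpha|+b}[\alpha,d\beta].$$ For a graded space $V$ let $V[k]$ be the same space with $V[k]_i=V_{i+k}$. On $\mathcal A[-a+1]$, write $dg(\alpha)=|\alpha|+a-1$, $\mu(\alpha,\beta)=(-1)^{dg(\alpha)}\alpha\cdot\beta$ and $\ell(\alpha,\beta)=(-1)^{(b-a+1)dg(\alpha)}[\alpha,\beta]$. Let $Bat(p,q)\subset S_{p+q}$ be the set of $\sigma$ with $\sigma(1)<\dots<\sigma(p)$ and $\sigma(p+1)<\dots<\sigma(p+q)$, let $\varepsilon_\alpha(\sigma^{-1})$ be the signature of the permutation that $\alpha_1\cdots\alpha_n\mapsto\alpha_{\sigma^{-1}(1)}\cdots\alpha_{\sigma^{-1}(n)}$ induces on the letters of odd degree $dg$, and let $$bat_{p,q}(\alpha_1\otimes\dots\otimes\alpha_p,\ \alpha_{p+1}\otimes\dots\otimes\alpha_{p+q})=\sum_{\sigma\in Bat(p,q)}\varepsilon_\alpha(\sigma^{-1})\,\alpha_{\sigma^{-1}(1)}\otimes\dots\otimes\alpha_{\sigma^{-1}(p+q)}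 .$$ Let $\mathcal H=\bigoplus_{n\ge1}\Big(\bigotimes^n\mathcal A[-a+1]\Big/\sum_{p+q=n,\ p,q\ge1}\mathrm{Im}(bat_{p,q})\Big)$, write $\alpha_1\underline\otimes\cdots\underline\otimes\alpha_n$ for the class of $\alpha_1\otimes\dots\otimes\alpha_n$, and grade $\mathcal H$ by $dg(\alpha_1\underline\otimes\cdots\underline\otimes\alpha_n)=\sum_i dg(\alpha_i)$. Then the following holds. The formulas below, for homogeneous $\alpha_i$ and $n,p,q\ge1$, give well-defined linear, respectively bilinear, maps $D=d_1+\mu_1:\mathcal H\to\mathcal H$ and $\ell_2:\mathcal H\times\mathcal H\to\mathcal H$: $$d_1(\alpha_1\underline\otimes\cdots\underline\otimes\alpha_n)=\sum_{1\le k\le n}(-1)^{\sum_{i<k}dg(\alpha_i)}\alpha_1\underline\otimes\cdots\underline\otimes d(\alpha_k)\underline\otimes\cdots\underline\otimes\alpha_n,$$ $$\mu_1(\alpha_1\underline\otimes\cdots\underline\otimes\alpha_n)=\sum_{1\le k<n}(-1)^{\sum_{i<k}dg(\alpha_i)}\alpha_1\underline\otimes\cdots\underline\otimes\mu(\alpha_k,\alpha_{k+1})\underline\otimes\cdots\underline\otimes\alpha_n,$$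 and, for $X=\alpha_1\underline\otimes\cdots\underline\otimes\alpha_p$ and $Y=\alpha_{p+1}\underline\otimes\cdots\underline\otimes\alpha_{p+q}$, $$\ell_2(X,Y)=\sum_{\substack{\sigma\in Bat(p,q),\ k\\ \sigma^{-1}(k)\le p<\sigma^{-1}(k+1)}}\varepsilon_\alpha(\sigma^{-1})(-1)^{(b-a+1)\sum_{s<k}dg(\alpha_{\sigma^{-1}(s)})}\,\alpha_{\sigma^{-1}(1)}\underline\otimes\cdots\underline\otimes\ell(\alpha_{\sigma^{-1}(k)},\alpha_{\sigma^{-1}(k+1)})\underline\otimes\cdots\underline\otimes\alpha_{\sigma^{-1}(p+q)} .$$ Consider $\mathcal H[a-b-1]$, in which the degree of a homogeneous $X\in\mathcal H$ is $x'=dg(X)-a+b+1$, and let $\ell'_2$ be the bilinear map with $\ell'_2(X,Y)=(-1)^{(a-b-1)x'}\ell_2(X,Y)$ for $X$ homogeneous. Then $(\mathcal H[a-b-1],\ell'_2,D)$ is a differential graded Lie algebra: $\mathcal H[a-b-1]$ is a graded vector space, $\ell'_2$ has degree $0$, $D$ has degree $1$, $D\circ D=0$, and for all homogeneous $X,Y,Z$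 of degrees $x',y',z'$ in $\mathcal H[a-b-1]$: (i) $\ell'_2(X,Y)=-(-1)^{x'y'}\ell'_2(Y,X)$; (ii) $(-1)^{x'z'}\ell'_2(\ell'_2(X,Y),Z)+(-1)^{y'x'}\ell'_2(\ell'_2(Y,Z),X)+(-1)^{z'y'}\ell'_2(\ell'_2(Z,X),Y)=0$; (iii) $D(\ell'_2(X,Y))=\ell'_2(D(X),Y)+(-1)^{x'}\ell'_2(X,D(Y))$. -/

import Mathlib

namespace ABHomotopy

variable {K : Type*} [Field K]

/-- A graded space `V = ⨁ᵢ Vᵢ` is given by its family of homogeneous components. The shifted space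
`V[k]` is the same space with `V[k]ᵢ = Vᵢ₊ₖ`. -/
def shift {V : Type*} [AddCommGroup V] [Module K V] (k : ℤ) (𝒱 : ℤ → Submodule K V) :
    ℤ → Submodule K V :=
  fun i => 𝒱 (i + k)

/-- Differential graded Lie algebra: bracket of degree `0`, differential of degree `1`. -/
structure IsDGLieAlgebra {V : Type*} [AddCommGroup V] [Module K V] (𝒱 : ℤ → Submodule K V)
    (br : V →ₗ[K] V →ₗ[K] V) (D : V →ₗ[K] V) : Prop where
  isInternal : DirectSum.IsInternal 𝒱
  br_mem : ∀ {x y : ℤ} {X Y : V}, X ∈ 𝒱 x → Y ∈ 𝒱 y → br X Y ∈ 𝒱 (x + y)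
  D_mem : ∀ {x : ℤ} {X : V}, X ∈ 𝒱 x → D X ∈ 𝒱 (x + 1)
  antisymm : ∀ {x y : ℤ} {X Y : V}, X ∈ 𝒱 x → Y ∈ 𝒱 y →
    br X Y = -((x * y).negOnePow • br Y X)
  jacobi : ∀ {x y z : ℤ} {X Y Z : V}, X ∈ 𝒱 x → Y ∈ 𝒱 y → Z ∈ 𝒱 z →
    (x * z).negOnePow • br (br X Y) Z + (y * x).negOnePow • br (br Y Z) X
      + (z * y).negOnePow • br (br Z X) Y = 0
  D_br : ∀ {x y : ℤ} {X Y : V}, X ∈ 𝒱 x → Y ∈ 𝒱 y →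
    D (br X Y) = br (D X) Y + x.negOnePow • br X (D Y)
  D_D : ∀ X : V, D (D X) = 0

variable {A : Type*} [AddCommGroup A] [Module K A]

/-- Differential graded `(a,b)`-algebra: a product of degree `a`, a bracket of degree `b` and a
differential of degree `1` on the graded space `A`, such that `A[-a]` is a graded commutative
associative algebra, `A[-b]` is a graded Lie algebra, the bracket satisfies the Leibniz identity,
and `d` is a derivation of both operations with `d ∘ d = 0`. -/
structure IsDGABAlgebra (a b : ℤ) (𝒜 : ℤ → Submodule K A)
    (mul bra : A →ₗ[K] A →ₗ[K] A) (d : A →ₗ[K] A) : Prop where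
  isInternal : DirectSum.IsInternal 𝒜
  mul_mem : ∀ {i j : ℤ} {α β : A}, α ∈ 𝒜 i → β ∈ 𝒜 j → mul α β ∈ 𝒜 (i + j + a)
  bra_mem : ∀ {i j : ℤ} {α β : A}, α ∈ 𝒜 i → β ∈ 𝒜 j → bra α β ∈ 𝒜 (i + j + b)
  d_mem : ∀ {i : ℤ} {α : A}, α ∈ 𝒜 i → d α ∈ 𝒜 (i + 1)
  mul_comm : ∀ {i j : ℤ} {α β : A}, α ∈ 𝒜 i → β ∈ 𝒜 j →
    mul α β = ((i + a) * (j + a)).negOnePow • mul β α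
  mul_assoc : ∀ α β γ : A, mul α (mul β γ) = mul (mul α β) γ
  bra_antisymm : ∀ {i j : ℤ} {α β : A}, α ∈ 𝒜 i → β ∈ 𝒜 j →
    bra α β = -(((i + b) * (j + b)).negOnePow • bra β α)
  jacobi : ∀ {i j k : ℤ} {α β γ : A}, α ∈ 𝒜 i → β ∈ 𝒜 j → γ ∈ 𝒜 k →
    ((i + b) * (k + b)).negOnePow • bra (bra α β) γ
      + ((j + b) * (i + b)).negOnePow • bra (bra β γ) α
      + ((k + b) * (j + b)).negOnePow • bra (bra γ α) β = 0
  leibniz : ∀ {i j k : ℤ} {α β γ : A}, α ∈ 𝒜 i → β ∈ 𝒜 j → γ ∈ 𝒜 k →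
    bra α (mul β γ) = mul (bra α β) γ + ((j + a) * (i + b)).negOnePow • mul β (bra α γ)
  d_d : ∀ α : A, d (d α) = 0
  d_mul : ∀ {i j : ℤ} {α β : A}, α ∈ 𝒜 i → β ∈ 𝒜 j →
    d (mul α β) = mul (d α) β + (i + a).negOnePow • mul α (d β)
  d_bra : ∀ {i j : ℤ} {α β : A}, α ∈ 𝒜 i → β ∈ 𝒜 j →
    d (bra α β) = bra (d α) β + (i + b).negOnePow • bra α (d β)

/-- Homogeneous elements of `A`, together with their degree. -/
abbrev HomEl (𝒜 : ℤ → Submodule K A) : Type _ := Σ i : ℤ, 𝒜 i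

section Words

variable (a : ℤ) {𝒜 : ℤ → Submodule K A}

/-- The degree `dg(α) = |α| + a - 1` in `A[-a+1]`. -/
def dg (x : HomEl 𝒜) : ℤ := x.1 + a - 1

/-- The total degree `dg(α₁) + ⋯ + dg(αₙ)` of a word. -/
def degWord {n : ℕ} (w : Fin n → HomEl 𝒜) : ℤ := ∑ i, dg a (w i)

/-- `dg(α₁) + ⋯ + dg(αₖ₋₁)`: the degree of the part of the word strictly before position `k`. -/
def degBefore {n : ℕ} (w : Fin n → HomEl 𝒜) (k : Fin n) : ℤ := ∑ s ∈ Finset.Iio k, dg a (w s)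

/-- `μ(α,β) = (-1)^{dg α} α·β`. -/
def muA (mul : A →ₗ[K] A →ₗ[K] A) (x y : HomEl 𝒜) : A :=
  (dg a x).negOnePow • mul x.2 y.2

/-- `ℓ(α,β) = (-1)^{(b-a+1) dg α} [α,β]`. -/
def ellA (b : ℤ) (bra : A →ₗ[K] A →ₗ[K] A) (x y : HomEl 𝒜) : A :=
  ((b - a + 1) * dg a x).negOnePow • bra x.2 y.2

/-- The underlying list of vectors of a word of homogeneous elements. -/
def letters {n : ℕ} (w : Fin n → HomEl 𝒜) : List A := List.ofFn fun i => ((w i).2 : A)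

/-- Replace the `r` letters of the word `w` at positions `k, …, k + r - 1` (counted from `0`) by the
single letter `m`. -/
def splice {n : ℕ} (w : Fin n → HomEl 𝒜) (k r : ℕ) (m : A) : List A :=
  (letters w).take k ++ m :: (letters w).drop (k + r)

/-- The `(p,q)`-shuffles: permutations `σ` of `p + q` letters with `σ(1) < ⋯ < σ(p)` and
`σ(p+1) < ⋯ < σ(p+q)`. -/
def Bat (p q : ℕ) : Finset (Equiv.Perm (Fin (p + q))) :=
  {σ | (∀ i j : Fin (p + q), i < j → (j : ℕ) < p → σ i < σ j) ∧
       (∀ i j : Fin (p + q), i < j → p ≤ (i : ℕ) → σ i < σ j)}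

/-- The Koszul sign `ε(α₁ … αₙ ; α_{σ⁻¹(1)} … α_{σ⁻¹(n)})`, i.e. the signature of the permutation
induced on the letters of odd degree. -/
def koszul {n : ℕ} (w : Fin n → HomEl 𝒜) (σ : Equiv.Perm (Fin n)) : ℤˣ :=
  ∏ ij ∈ (Finset.univ : Finset (Fin n × Fin n)) with ij.1 < ij.2 ∧ σ ij.2 < σ ij.1,
    (dg a (w ij.1) * dg a (w ij.2)).negOnePow

/-- The rearranged word `α_{σ⁻¹(1)}, …, α_{σ⁻¹(n)}`. -/
def permWord {n : ℕ} (σ : Equiv.Perm (Fin n)) (w : Fin n → HomEl 𝒜) : Fin n → HomEl 𝒜 :=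
  fun i => w (σ⁻¹ i)

end Words

section Space

variable (K) in
/-- The tensor `α₁ ⊗ ⋯ ⊗ αₙ` in the tensor algebra of `A`. -/
def tens (l : List A) : TensorAlgebra K A := (l.map (TensorAlgebra.ι K)).prod

variable (K A) in
/-- `⨂⁺ A = ⨁_{n ≥ 1} ⨂ⁿ A`, as a subspace of the tensor algebra. -/
def Tplus : Submodule K (TensorAlgebra K A) :=
  ⨆ n : ℕ, LinearMap.range (TensorAlgebra.ι K (M := A)) ^ (n + 1)

theorem tens_mem_pow (l : List A) :
    tens K l ∈ LinearMap.range (TensorAlgebra.ι K (M := A)) ^ l.length := by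
  induction l with
  | nil => simp [tens]
  | cons x l ih =>
    rw [List.length_cons, pow_succ']
    have h : tens K (x :: l) = TensorAlgebra.ι K x * tens K l := by simp [tens]
    rw [h]
    exact Submodule.mul_mem_mul ⟨x, rfl⟩ ih

theorem tens_cons_mem (x : A) (l : List A) : tens K (x :: l) ∈ Tplus K A :=
  Submodule.mem_iSup_of_mem l.length (tens_mem_pow (x :: l))

variable (a : ℤ) (𝒜 : ℤ → Submodule K A)

/-- The shuffle product `bat_{p,q}(α, β)` of two words, in the tensor algebra. -/
def bat {𝒜 : ℤ → Submodule K A} {p q : ℕ} (u : Fin p → HomEl 𝒜) (v : Fin q → HomEl 𝒜) :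
    TensorAlgebra K A :=
  ∑ σ ∈ Bat p q, koszul a (Fin.append u v) σ • tens K (letters (permWord σ (Fin.append u v)))

/-- The sum of the images of all the maps `bat_{p,q}`, `p, q ≥ 1`. -/
def shuffles : Submodule K (TensorAlgebra K A) :=
  Submodule.span K {t | ∃ (p q : ℕ) (u : Fin p → HomEl 𝒜) (v : Fin q → HomEl 𝒜),
    1 ≤ p ∧ 1 ≤ q ∧ t = bat a u v}

/-- The space `H = ⨁_{n ≥ 1} ⨂ⁿ(A[-a+1]) / ∑_{p+q=n} Im bat_{p,q}`. -/
abbrev H : Type _ := Tplus K A ⧸ (shuffles a 𝒜).submoduleOf (Tplus K A)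

/-- The class in `H` of the tensor `α₁ ⊗ ⋯ ⊗ αₙ`, `n ≥ 1` (and `0` for the empty list). -/
def cls : List A → H a 𝒜
  | [] => 0
  | x :: l => Submodule.Quotient.mk ⟨tens K (x :: l), tens_cons_mem x l⟩

/-- The grading of `H`: `dg(α₁ ⊗ ⋯ ⊗ αₙ) = dg(α₁) + ⋯ + dg(αₙ)`. -/
def gradH (x : ℤ) : Submodule K (H a 𝒜) :=
  Submodule.span K {X | ∃ (n : ℕ) (w : Fin n → HomEl 𝒜),
    1 ≤ n ∧ degWord a w = x ∧ X = cls a 𝒜 (letters w)}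

variable {𝒜}

/-- `d₁(α₁ ⊗ ⋯ ⊗ αₙ) = ∑ₖ (-1)^{∑_{i<k} dg αᵢ} α₁ ⊗ ⋯ ⊗ d(αₖ) ⊗ ⋯ ⊗ αₙ`. -/
def dOne (d : A →ₗ[K] A) {n : ℕ} (w : Fin n → HomEl 𝒜) : H a 𝒜 :=
  ∑ k : Fin n, (degBefore a w k).negOnePow • cls a 𝒜 (splice w k 1 (d (w k).2))

/-- `μ₁(α₁ ⊗ ⋯ ⊗ αₙ) = ∑_{k<n} (-1)^{∑_{i<k} dg αᵢ} α₁ ⊗ ⋯ ⊗ μ(αₖ,αₖ₊₁) ⊗ ⋯ ⊗ αₙ`.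
The sum runs over the pairs `k = (position, next position)`. -/
def muOne (mul : A →ₗ[K] A →ₗ[K] A) {n : ℕ} (w : Fin n → HomEl 𝒜) : H a 𝒜 :=
  ∑ k ∈ (Finset.univ : Finset (Fin n × Fin n)) with (k.2 : ℕ) = k.1 + 1,
    (degBefore a w k.1).negOnePow • cls a 𝒜 (splice w k.1 2 (muA a mul (w k.1) (w k.2)))

/-- `ℓ₂(X, Y)` for `X = α₁ ⊗ ⋯ ⊗ αₚ` and `Y = αₚ₊₁ ⊗ ⋯ ⊗ αₚ₊q`: the sum over `σ ∈ Bat(p,q)` and over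
the positions `k` with `σ⁻¹(k) ≤ p < σ⁻¹(k+1)` of
`ε(σ⁻¹) (-1)^{(b-a+1) ∑_{s<k} dg α_{σ⁻¹(s)}}
  α_{σ⁻¹(1)} ⊗ ⋯ ⊗ ℓ(α_{σ⁻¹(k)}, α_{σ⁻¹(k+1)}) ⊗ ⋯ ⊗ α_{σ⁻¹(p+q)}`. -/
def ellTwo (b : ℤ) (bra : A →ₗ[K] A →ₗ[K] A) {p q : ℕ}
    (u : Fin p → HomEl 𝒜) (v : Fin q → HomEl 𝒜) : H a 𝒜 :=
  ∑ σ ∈ Bat p q,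
    ∑ k ∈ (Finset.univ : Finset (Fin (p + q) × Fin (p + q))) with
        (k.2 : ℕ) = k.1 + 1 ∧ ((σ⁻¹ k.1 : Fin (p + q)) : ℕ) < p ∧
          p ≤ ((σ⁻¹ k.2 : Fin (p + q)) : ℕ),
      (koszul a (Fin.append u v) σ *
          ((b - a + 1) * degBefore a (permWord σ (Fin.append u v)) k.1).negOnePow) •
        cls a 𝒜 (splice (permWord σ (Fin.append u v)) k.1 2
          (ellA a b bra (permWord σ (Fin.append u v) k.1) (permWord σ (Fin.append u v) k.2)))

end Space

end ABHomotopy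

/-!
Regraded by `dg`, the space `𝒜[-a+1]` is a differential graded `(1, c)`-algebra with
`c = b - a + 1`. Its tensor algebra, with the signed shuffle product, the biderivation extending
the bracket and the coderivation extending product and differential, is a differential graded
`(0, c)`-algebra: every identity follows by induction on the lengths of the words, splitting off
first letters. Bracket and differential are derivations of the shuffle product with values in the
augmentation ideal, so both preserve the shuffle products of elements of that ideal and descend to
`H`. Shifting the degrees by `-c` turns the bracket into one of degree `0`, which leaves a
differential graded Lie algebra; the sum over `Bat(p, q)` defining `ℓ₂` is `(-1) ^ (c * dg X)`
times this bracket.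
-/

namespace ABHomotopy

/-! ### Signs and words -/

variable {K : Type*} [Field K]

section Signs

variable (K) in
/-- The sign `(-1)ⁿ` as a scalar of `K`, for use with tactics that normalise `K`-linear
combinations. -/
def sg (n : ℤ) : K := ((n.negOnePow : ℤ) : K)

theorem negOnePow_smul_eq_sg_smul {N : Type*} [AddCommGroup N] [Module K N] (n : ℤ) (x : N) :
    n.negOnePow • x = sg K n • x := by
  rw [sg, Units.smul_def, Int.cast_smul_eq_zsmul]

@[simp] theorem sg_zero : sg K 0 = 1 := by simp [sg]

@[simp] theorem sg_one : sg K 1 = -1 := by simp [sg]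

theorem sg_neg (m : ℤ) : sg K (-m) = sg K m := by simp [sg]

theorem sg_add (m n : ℤ) : sg K (m + n) = sg K m * sg K n := by
  simp [sg, Int.negOnePow_add]

theorem sg_mul_sg (m : ℤ) : sg K m * sg K m = 1 := by
  rw [← sg_add, ← two_mul]
  simp [sg]

theorem sg_mul_sg_mul (m : ℤ) (r : K) : sg K m * (sg K m * r) = r := by
  rw [← mul_assoc, sg_mul_sg, one_mul]

theorem sg_pow (m : ℤ) (n : ℕ) : sg K m ^ n = if n % 2 = 0 then 1 else sg K m := by
  conv_lhs => rw [← Nat.div_add_mod n 2, pow_add, pow_mul, pow_two, sg_mul_sg, one_pow, one_mul]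
  rcases Nat.mod_two_eq_zero_or_one n with h | h <;> simp [h]

theorem sg_mul_self (m : ℤ) : sg K (m * m) = sg K m := by
  have h : (m * m).negOnePow = m.negOnePow := by
    rw [Int.negOnePow_eq_iff]
    simpa [mul_sub] using Int.even_mul_pred_self m
  rw [sg, h, sg]

end Signs

theorem eqOn_span₂ {R M N P : Type*} [CommRing R] [AddCommGroup M] [AddCommGroup N]
    [AddCommGroup P] [Module R M] [Module R N] [Module R P] {f g : M →ₗ[R] N →ₗ[R] P}
    {s : Set M} {t : Set N} (h : ∀ x ∈ s, ∀ y ∈ t, f x y = g x y) {x : M} {y : N}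
    (hx : x ∈ Submodule.span R s) (hy : y ∈ Submodule.span R t) : f x y = g x y := by
  have := LinearMap.BilinMap.apply_apply_mem_of_mem_span ⊥ s t (f - g)
    (fun x hx y hy => by simp [h x hx y hy]) x y hx hy
  simpa [sub_eq_zero] using this

variable {A : Type*} [AddCommGroup A] [Module K A] {a : ℤ} {ℬ 𝒜 : ℤ → Submodule K A}

section Words

/-- The bilinear map `(x, U) ↦ x ⊗ U` that puts a letter in front of a tensor. -/
def cons : A →ₗ[K] TensorAlgebra K A →ₗ[K] TensorAlgebra K A :=
  LinearMap.mul K (TensorAlgebra K A) ∘ₗ TensorAlgebra.ι K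

theorem cons_apply (x : A) (U : TensorAlgebra K A) : cons x U = TensorAlgebra.ι K x * U := rfl

theorem tens_nil : tens K ([] : List A) = 1 := rfl

theorem tens_cons (x : A) (l : List A) : tens K (x :: l) = cons x (tens K l) := by
  simp [tens, cons_apply]

/-- The tensor of a list of homogeneous letters. -/
def word (u : List (HomEl ℬ)) : TensorAlgebra K A := tens K (u.map fun x => (x.2 : A))

/-- The sum of the degrees of the letters of a list. -/
def wordDeg (u : List (HomEl ℬ)) : ℤ := (u.map Sigma.fst).sum

theorem word_nil : word ([] : List (HomEl ℬ)) = 1 := rfl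

theorem word_cons (x : HomEl ℬ) (u : List (HomEl ℬ)) : word (x :: u) = cons (x.2 : A) (word u) :=
  tens_cons _ _

theorem wordDeg_nil : wordDeg ([] : List (HomEl ℬ)) = 0 := rfl

theorem wordDeg_cons (x : HomEl ℬ) (u : List (HomEl ℬ)) : wordDeg (x :: u) = x.1 + wordDeg u := by
  simp [wordDeg]

variable (ℬ) in
/-- The grading of the tensor algebra by the total degree of words. -/
def gradT (m : ℤ) : Submodule K (TensorAlgebra K A) :=
  Submodule.span K (word '' {u : List (HomEl ℬ) | wordDeg u = m})

theorem word_mem (u : List (HomEl ℬ)) : word u ∈ gradT ℬ (wordDeg u) :=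
  Submodule.subset_span ⟨u, rfl, rfl⟩

theorem one_mem_gradT : (1 : TensorAlgebra K A) ∈ gradT ℬ 0 :=
  word_mem (ℬ := ℬ) []

theorem cons_mem {i m : ℤ} {x : A} {U : TensorAlgebra K A} (hx : x ∈ ℬ i) (hU : U ∈ gradT ℬ m) :
    cons x U ∈ gradT ℬ (i + m) := by
  refine (Submodule.map_span_le (cons x) _ _).2 ?_ (Submodule.mem_map_of_mem hU)
  rintro _ ⟨u, rfl, rfl⟩
  rw [← word_cons ⟨i, x, hx⟩, ← wordDeg_cons ⟨i, x, hx⟩]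
  exact word_mem _

theorem basis_tensorAlgebra_apply {κ : Type*} (e : Module.Basis κ K A) (l : FreeMonoid κ) :
    e.tensorAlgebra l = tens K (l.toList.map e) := by
  have hfree : FreeAlgebra.basisFreeMonoid K κ l = FreeMonoid.lift (FreeAlgebra.ι K) l := by
    simp [FreeAlgebra.basisFreeMonoid, FreeAlgebra.equivMonoidAlgebraFreeMonoid]
  rw [Module.Basis.tensorAlgebra, Module.Basis.map_apply, hfree]
  change (TensorAlgebra.equivFreeAlgebra e).symm _ = _
  clear hfree
  induction l using FreeMonoid.inductionOn' with
  | one => simp [tens]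
  | of_mul x xs ih =>
    rw [map_mul, map_mul, ih]
    simp [tens]

variable {N : Type*} [AddCommGroup N] [Module K N] {m n : ℤ} {U V : TensorAlgebra K A}

theorem apply_apply_mem_of_words {f : TensorAlgebra K A →ₗ[K] TensorAlgebra K A →ₗ[K] N}
    {S : Submodule K N} (hU : U ∈ gradT ℬ m) (hV : V ∈ gradT ℬ n)
    (h : ∀ u v : List (HomEl ℬ), wordDeg u = m → wordDeg v = n → f (word u) (word v) ∈ S) :
    f U V ∈ S := by
  refine LinearMap.BilinMap.apply_apply_mem_of_mem_span S _ _ f ?_ U V hU hV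
  rintro _ ⟨u, hu, rfl⟩ _ ⟨v, hv, rfl⟩
  exact h u v hu hv

theorem eq_of_words {f g : TensorAlgebra K A →ₗ[K] N} (hU : U ∈ gradT ℬ m)
    (h : ∀ u : List (HomEl ℬ), wordDeg u = m → f (word u) = g (word u)) : f U = g U := by
  refine LinearMap.eqOn_span ?_ hU
  rintro _ ⟨u, hu, rfl⟩
  exact h u hu

theorem eq_of_words₂ {f g : TensorAlgebra K A →ₗ[K] TensorAlgebra K A →ₗ[K] N}
    (hU : U ∈ gradT ℬ m) (hV : V ∈ gradT ℬ n)
    (h : ∀ u v : List (HomEl ℬ), wordDeg u = m → wordDeg v = n →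
      f (word u) (word v) = g (word u) (word v)) :
    f U V = g U V := by
  refine eqOn_span₂ ?_ hU hV
  rintro _ ⟨u, hu, rfl⟩ _ ⟨v, hv, rfl⟩
  exact h u v hu hv

end Words

namespace IsDGABAlgebra

variable {b i j k : ℤ} {mul bra : A →ₗ[K] A →ₗ[K] A} {d : A →ₗ[K] A}
  {x y z : A}

theorem bra_swap (h : IsDGABAlgebra a b 𝒜 mul bra d) (hx : x ∈ 𝒜 i) (hy : y ∈ 𝒜 j) :
    bra x y = -sg K ((i + b) * (j + b)) • bra y x := by
  rw [h.bra_antisymm hx hy, negOnePow_smul_eq_sg_smul (K := K), neg_smul]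

theorem bra_bra (h : IsDGABAlgebra a b 𝒜 mul bra d) (hx : x ∈ 𝒜 i) (hy : y ∈ 𝒜 j)
    (hz : z ∈ 𝒜 k) :
    bra x (bra y z) = bra (bra x y) z + sg K ((i + b) * (j + b)) • bra y (bra x z) := by
  have hjac := h.jacobi hx hy hz
  simp only [negOnePow_smul_eq_sg_smul (K := K)] at hjac
  rw [h.bra_swap (h.bra_mem hy hz) hx, h.bra_swap (h.bra_mem hz hx) hy, h.bra_swap hz hx] at hjac
  simp only [map_smul] at hjac
  linear_combination (norm := skip) -sg K ((i + b) * (k + b)) • hjac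
  match_scalars <;> simp only [mul_add, sg_add, sg_mul_self, _root_.mul_comm] <;>
    ring_nf <;> simp [sg_pow]

theorem bra_mul (h : IsDGABAlgebra a b 𝒜 mul bra d) (hx : x ∈ 𝒜 i) (hy : y ∈ 𝒜 j)
    (hz : z ∈ 𝒜 k) :
    bra (mul x y) z = mul x (bra y z) + sg K ((j + a) * (k + b)) • mul (bra x z) y := by
  rw [h.bra_swap (h.mul_mem hx hy) hz, h.leibniz hz hx hy, h.bra_swap hz hx, h.bra_swap hz hy,
    negOnePow_smul_eq_sg_smul (K := K)]
  simp only [map_smul, LinearMap.smul_apply]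
  match_scalars <;> simp only [mul_add, sg_add, sg_mul_self, _root_.mul_comm] <;>
    ring_nf <;> simp [sg_pow]

end IsDGABAlgebra

/-! ### Homogeneous bases -/

/-- A basis of `A` adapted to the grading `ℬ`. It serves to define bilinear maps on the tensor
algebra by recursion on words; their properties are then stated for all homogeneous elements. -/
structure HomogeneousBasis (ℬ : ℤ → Submodule K A) (I : Type*) where
  letter : Module.Basis I K A
  deg : I → ℤ
  span_letter : ∀ i, Submodule.span K (letter '' {k | deg k = i}) = ℬ i

/-- A homogeneous basis obtained by choosing a basis of every component. -/
noncomputable def HomogeneousBasis.ofIsInternal (h : DirectSum.IsInternal ℬ) :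
    HomogeneousBasis ℬ (Σ i, Module.Basis.ofVectorSpaceIndex K (ℬ i)) where
  letter := h.collectedBasis fun i => Module.Basis.ofVectorSpace K (ℬ i)
  deg := Sigma.fst
  span_letter i := by
    set v := fun i => Module.Basis.ofVectorSpace K (ℬ i)
    have himage : (h.collectedBasis v) '' {s | s.1 = i} = (ℬ i).subtype '' Set.range (v i) := by
      ext x
      simp only [Set.mem_image, Set.mem_ofPred_eq, Set.mem_range, exists_exists_eq_and]
      constructor
      · rintro ⟨⟨i, k⟩, rfl, rfl⟩
        exact ⟨k, by simp [DirectSum.IsInternal.collectedBasis_coe]⟩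
      · rintro ⟨k, rfl⟩
        exact ⟨⟨i, k⟩, rfl, by simp [DirectSum.IsInternal.collectedBasis_coe]⟩
    rw [himage, Submodule.span_image, (v i).span_eq, Submodule.map_top, Submodule.range_subtype]

namespace HomogeneousBasis

variable {I : Type*} (B : HomogeneousBasis ℬ I) {c i j m n p : ℤ} {x y z : A}
  {U V W : TensorAlgebra K A} {mul bra : A →ₗ[K] A →ₗ[K] A} {d : A →ₗ[K] A}

theorem letter_mem (k : I) : B.letter k ∈ ℬ (B.deg k) := by
  rw [← B.span_letter]
  exact Submodule.subset_span ⟨k, rfl, rfl⟩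

/-- The basis of the tensor algebra consisting of the words in the basis letters. -/
noncomputable def wordBasis : Module.Basis (List I) K (TensorAlgebra K A) :=
  B.letter.tensorAlgebra.reindex FreeMonoid.toList

/-- The sum of the degrees of the basis letters of a word. -/
def indexDeg (u : List I) : ℤ := (u.map B.deg).sum

theorem wordBasis_apply (u : List I) : B.wordBasis u = tens K (u.map B.letter) := by
  simp [wordBasis, basis_tensorAlgebra_apply]

@[simp] theorem wordBasis_nil : B.wordBasis [] = 1 := by
  simp [wordBasis_apply, tens_nil]

theorem wordBasis_cons (k : I) (u : List I) :
    B.wordBasis (k :: u) = cons (B.letter k) (B.wordBasis u) := by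
  simp [wordBasis_apply, tens_cons]

theorem indexDeg_cons (k : I) (u : List I) : B.indexDeg (k :: u) = B.deg k + B.indexDeg u := by
  simp [indexDeg]

theorem wordBasis_eq_word (u : List I) :
    B.wordBasis u = word (u.map fun k => (⟨B.deg k, B.letter k, B.letter_mem k⟩ : HomEl ℬ)) := by
  rw [wordBasis_apply, word, List.map_map]
  rfl

theorem wordBasis_mem (u : List I) : B.wordBasis u ∈ gradT ℬ (B.indexDeg u) := by
  rw [wordBasis_eq_word]
  convert word_mem (ℬ := ℬ) _
  rw [wordDeg, List.map_map]
  rfl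

theorem span_wordBasis (m : ℤ) :
    Submodule.span K (B.wordBasis '' {u | B.indexDeg u = m}) = gradT ℬ m := by
  refine le_antisymm (Submodule.span_le.2 ?_) (Submodule.span_le.2 ?_)
  · rintro _ ⟨u, rfl, rfl⟩
    exact B.wordBasis_mem u
  rintro _ ⟨u, rfl, rfl⟩
  induction u with
  | nil => exact Submodule.subset_span ⟨[], rfl, B.wordBasis_nil⟩
  | cons x u ih =>
    have hx : (x.2 : A) ∈ Submodule.span K (B.letter '' {k | B.deg k = x.1}) := by
      rw [B.span_letter]
      exact x.2.2
    rw [SetLike.mem_coe, word_cons, wordDeg_cons]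
    refine LinearMap.BilinMap.apply_apply_mem_of_mem_span _ _ _ cons ?_ _ _ hx ih
    rintro _ ⟨k, hk, rfl⟩ _ ⟨v, hv, rfl⟩
    rw [← wordBasis_cons]
    exact Submodule.subset_span ⟨k :: v, by rw [Set.mem_ofPred_eq, indexDeg_cons, hk, hv], rfl⟩

/-! ### The shuffle product -/

/-- The signed shuffle product of two words in the basis letters. -/
noncomputable def shuffleWords : List I → List I → TensorAlgebra K A
  | [], v => B.wordBasis v
  | i :: u, [] => B.wordBasis (i :: u)
  | i :: u, j :: v => cons (B.letter i) (shuffleWords u (j :: v)) +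
      sg K (B.deg j * (B.deg i + B.indexDeg u)) • cons (B.letter j) (shuffleWords (i :: u) v)

/-- The signed shuffle product on the tensor algebra. -/
@[irreducible] noncomputable def shuffle :
    TensorAlgebra K A →ₗ[K] TensorAlgebra K A →ₗ[K] TensorAlgebra K A :=
  B.wordBasis.constr K fun u => B.wordBasis.constr K fun v => B.shuffleWords u v

theorem shuffle_wordBasis (u v : List I) :
    B.shuffle (B.wordBasis u) (B.wordBasis v) = B.shuffleWords u v := by
  simp [shuffle, Module.Basis.constr_basis]

@[simp] theorem one_shuffle (V : TensorAlgebra K A) : B.shuffle 1 V = V := by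
  have : B.shuffle (B.wordBasis []) = LinearMap.id :=
    B.wordBasis.ext fun v => by rw [shuffle_wordBasis, shuffleWords, LinearMap.id_apply]
  rw [← B.wordBasis_nil, this, LinearMap.id_apply]

@[simp] theorem shuffle_one (U : TensorAlgebra K A) : B.shuffle U 1 = U := by
  have : B.shuffle.flip (B.wordBasis []) = LinearMap.id := B.wordBasis.ext fun u => by
    cases u <;> rw [LinearMap.flip_apply, shuffle_wordBasis, shuffleWords, LinearMap.id_apply]
  rw [← B.wordBasis_nil]
  exact LinearMap.congr_fun this U

theorem shuffle_cons_cons (hx : x ∈ ℬ i) (hU : U ∈ gradT ℬ m) (hy : y ∈ ℬ j) :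
    B.shuffle (cons x U) (cons y V) =
      cons x (B.shuffle U (cons y V)) + sg K (j * (i + m)) • cons y (B.shuffle (cons x U) V) := by
  rw [← B.span_letter] at hx hy
  rw [← B.span_wordBasis] at hU
  refine eqOn_span₂ (f := B.shuffle.compl₁₂ (cons.flip U) (cons.flip V))
    (g := cons.compl₂ (B.shuffle U ∘ₗ cons.flip V) +
      sg K (j * (i + m)) • (cons.compl₂ (B.shuffle.flip V ∘ₗ cons.flip U)).flip) ?_ hx hy
  rintro _ ⟨k, rfl, rfl⟩ _ ⟨l, rfl, rfl⟩
  refine eqOn_span₂ (f := B.shuffle.compl₁₂ (cons (B.letter k)) (cons (B.letter l)))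
    (g := (B.shuffle.compl₂ (cons (B.letter l))).compr₂ (cons (B.letter k)) +
      sg K (B.deg l * (B.deg k + m)) •
        (B.shuffle ∘ₗ cons (B.letter k)).compr₂ (cons (B.letter l)))
    ?_ hU (B.wordBasis.mem_span V)
  rintro _ ⟨u, rfl, rfl⟩ _ ⟨v, rfl⟩
  simp [← wordBasis_cons, shuffle_wordBasis, shuffleWords]

theorem shuffle_word_mem : ∀ u v : List (HomEl ℬ),
    B.shuffle (word u) (word v) ∈ gradT ℬ (wordDeg u + wordDeg v)
  | [], v => by simpa [word_nil, wordDeg_nil] using word_mem v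
  | u, [] => by simpa [word_nil, wordDeg_nil] using word_mem u
  | x :: u, y :: v => by
    have hu := shuffle_word_mem u (y :: v)
    have hv := shuffle_word_mem (x :: u) v
    simp only [word_cons, wordDeg_cons] at hu hv ⊢
    rw [B.shuffle_cons_cons x.2.2 (word_mem u) y.2.2]
    refine add_mem ?_ (Submodule.smul_mem _ _ ?_)
    · simpa only [add_assoc] using cons_mem x.2.2 hu
    · simpa only [add_left_comm] using cons_mem y.2.2 hv
  termination_by u v => u.length + v.length

theorem shuffle_mem (hU : U ∈ gradT ℬ m) (hV : V ∈ gradT ℬ n) :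
    B.shuffle U V ∈ gradT ℬ (m + n) := by
  refine apply_apply_mem_of_words hU hV ?_
  rintro u v rfl rfl
  exact B.shuffle_word_mem u v

theorem shuffle_comm_word : ∀ u v : List (HomEl ℬ),
    B.shuffle (word u) (word v) = sg K (wordDeg u * wordDeg v) • B.shuffle (word v) (word u)
  | [], v => by simp [word_nil, wordDeg_nil]
  | u, [] => by simp [word_nil, wordDeg_nil]
  | x :: u, y :: v => by
    have hu := shuffle_comm_word u (y :: v)
    have hv := shuffle_comm_word (x :: u) v
    simp only [word_cons, wordDeg_cons] at hu hv ⊢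
    rw [B.shuffle_cons_cons x.2.2 (word_mem u) y.2.2, B.shuffle_cons_cons y.2.2 (word_mem v) x.2.2,
      hu, hv]
    simp only [map_smul]
    match_scalars <;> simp only [mul_add, sg_add, mul_comm, mul_left_comm, mul_assoc,
      sg_mul_sg_mul, mul_one]
  termination_by u v => u.length + v.length

theorem shuffle_comm (hU : U ∈ gradT ℬ m) (hV : V ∈ gradT ℬ n) :
    B.shuffle U V = sg K (m * n) • B.shuffle V U := by
  refine eq_of_words₂ (g := sg K (m * n) • B.shuffle.flip) hU hV ?_
  rintro u v rfl rfl
  exact B.shuffle_comm_word u v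

theorem shuffle_assoc_word : ∀ u v w : List (HomEl ℬ),
    B.shuffle (B.shuffle (word u) (word v)) (word w) =
      B.shuffle (word u) (B.shuffle (word v) (word w))
  | [], v, w => by simp [word_nil]
  | u, [], w => by simp [word_nil]
  | u, v, [] => by simp [word_nil]
  | x :: u, y :: v, z :: w => by
    have hu := shuffle_assoc_word u (y :: v) (z :: w)
    have hv := shuffle_assoc_word (x :: u) v (z :: w)
    have hw := shuffle_assoc_word (x :: u) (y :: v) w
    have hxu := cons_mem x.2.2 (word_mem u)
    have hyv := cons_mem y.2.2 (word_mem v)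
    simp only [word_cons, B.shuffle_cons_cons x.2.2 (word_mem u) y.2.2,
      B.shuffle_cons_cons y.2.2 (word_mem v) z.2.2, map_add, map_smul, LinearMap.add_apply,
      LinearMap.smul_apply] at hu hv hw ⊢
    rw [B.shuffle_cons_cons x.2.2 (B.shuffle_mem (word_mem u) hyv) z.2.2,
      B.shuffle_cons_cons y.2.2 (B.shuffle_mem hxu (word_mem v)) z.2.2,
      B.shuffle_cons_cons x.2.2 (word_mem u) z.2.2,
      hu, hv, ← hw]
    simp only [map_add, map_smul]
    match_scalars <;> simp only [mul_add, sg_add, mul_comm, mul_left_comm, mul_assoc]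
  termination_by u v w => u.length + v.length + w.length

theorem shuffle_assoc (U V W : TensorAlgebra K A) :
    B.shuffle (B.shuffle U V) W = B.shuffle U (B.shuffle V W) := by
  have h : B.shuffle.compr₂ B.shuffle =
      (LinearMap.llcomp K _ _ _).compl₁₂ B.shuffle B.shuffle := by
    refine B.wordBasis.ext fun u => B.wordBasis.ext fun v => B.wordBasis.ext fun w => ?_
    simp only [wordBasis_eq_word]
    exact B.shuffle_assoc_word _ _ _
  exact LinearMap.congr_fun (LinearMap.congr_fun₂ h U V) W

theorem shuffle_left_comm (hU : U ∈ gradT ℬ m) (hV : V ∈ gradT ℬ n) (W : TensorAlgebra K A) :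
    B.shuffle V (B.shuffle U W) = sg K (n * m) • B.shuffle U (B.shuffle V W) := by
  rw [← B.shuffle_assoc, B.shuffle_comm hV hU, map_smul, LinearMap.smul_apply, B.shuffle_assoc]

/-! ### The bracket -/

/-- The bracket of two words in the basis letters. -/
noncomputable def bracketWords (c : ℤ) (bra : A →ₗ[K] A →ₗ[K] A) :
    List I → List I → TensorAlgebra K A
  | [], _ => 0
  | _ :: _, [] => 0
  | i :: u, j :: v => cons (B.letter i) (bracketWords c bra u (j :: v)) +
      sg K (B.deg j * (c + (B.deg i + B.indexDeg u))) •
        cons (B.letter j) (bracketWords c bra (i :: u) v) +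
      sg K (B.indexDeg u * (B.deg j + c)) •
        cons (bra (B.letter i) (B.letter j)) (B.shuffleWords u v)

/-- The extension of a bracket of degree `c` on the letters to a biderivation of the shuffle
product. -/
@[irreducible] noncomputable def bracket (c : ℤ) (bra : A →ₗ[K] A →ₗ[K] A) :
    TensorAlgebra K A →ₗ[K] TensorAlgebra K A →ₗ[K] TensorAlgebra K A :=
  B.wordBasis.constr K fun u => B.wordBasis.constr K fun v => B.bracketWords c bra u v

theorem bracket_wordBasis (u v : List I) :
    B.bracket c bra (B.wordBasis u) (B.wordBasis v) = B.bracketWords c bra u v := by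
  simp [bracket, Module.Basis.constr_basis]

@[simp] theorem one_bracket (V : TensorAlgebra K A) : B.bracket c bra 1 V = 0 := by
  have : B.bracket c bra (B.wordBasis []) = 0 :=
    B.wordBasis.ext fun v => by rw [bracket_wordBasis, bracketWords, LinearMap.zero_apply]
  rw [← B.wordBasis_nil, this, LinearMap.zero_apply]

@[simp] theorem bracket_one (U : TensorAlgebra K A) : B.bracket c bra U 1 = 0 := by
  have : (B.bracket c bra).flip (B.wordBasis []) = 0 := B.wordBasis.ext fun u => by
    cases u <;> rw [LinearMap.flip_apply, bracket_wordBasis, bracketWords, LinearMap.zero_apply]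
  rw [← B.wordBasis_nil]
  exact LinearMap.congr_fun this U

theorem bracket_cons_cons (hx : x ∈ ℬ i) (hU : U ∈ gradT ℬ m) (hy : y ∈ ℬ j) :
    B.bracket c bra (cons x U) (cons y V) =
      cons x (B.bracket c bra U (cons y V)) +
      sg K (j * (c + (i + m))) • cons y (B.bracket c bra (cons x U) V) +
      sg K (m * (j + c)) • cons (bra x y) (B.shuffle U V) := by
  rw [← B.span_letter] at hx hy
  rw [← B.span_wordBasis] at hU
  refine eqOn_span₂ (f := (B.bracket c bra).compl₁₂ (cons.flip U) (cons.flip V))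
    (g := cons.compl₂ (B.bracket c bra U ∘ₗ cons.flip V) +
      sg K (j * (c + (i + m))) • (cons.compl₂ ((B.bracket c bra).flip V ∘ₗ cons.flip U)).flip +
      sg K (m * (j + c)) • bra.compr₂ (cons.flip (B.shuffle U V))) ?_ hx hy
  rintro _ ⟨k, rfl, rfl⟩ _ ⟨l, rfl, rfl⟩
  refine eqOn_span₂
    (f := (B.bracket c bra).compl₁₂ (cons (B.letter k)) (cons (B.letter l)))
    (g := ((B.bracket c bra).compl₂ (cons (B.letter l))).compr₂ (cons (B.letter k)) +
      sg K (B.deg l * (c + (B.deg k + m))) •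
        (B.bracket c bra ∘ₗ cons (B.letter k)).compr₂ (cons (B.letter l)) +
      sg K (m * (B.deg l + c)) • B.shuffle.compr₂ (cons (bra (B.letter k) (B.letter l))))
    ?_ hU (B.wordBasis.mem_span V)
  rintro _ ⟨u, rfl, rfl⟩ _ ⟨v, rfl⟩
  simp [← wordBasis_cons, bracket_wordBasis, shuffle_wordBasis, bracketWords]

theorem bracket_word_mem (h : IsDGABAlgebra 1 c ℬ mul bra d) : ∀ u v : List (HomEl ℬ),
    B.bracket c bra (word u) (word v) ∈ gradT ℬ (wordDeg u + wordDeg v + c)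
  | [], v => by simp [word_nil]
  | u, [] => by simp [word_nil]
  | x :: u, y :: v => by
    have hu := bracket_word_mem h u (y :: v)
    have hv := bracket_word_mem h (x :: u) v
    simp only [word_cons, wordDeg_cons] at hu hv ⊢
    rw [B.bracket_cons_cons x.2.2 (word_mem u) y.2.2]
    refine add_mem (add_mem ?_ (Submodule.smul_mem _ _ ?_)) (Submodule.smul_mem _ _ ?_)
    · convert cons_mem x.2.2 hu using 2
      ring
    · convert cons_mem y.2.2 hv using 2
      ring
    · convert cons_mem (h.bra_mem x.2.2 y.2.2) (B.shuffle_word_mem u v) using 2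
      ring
  termination_by u v => u.length + v.length

theorem bracket_mem (h : IsDGABAlgebra 1 c ℬ mul bra d) (hU : U ∈ gradT ℬ m)
    (hV : V ∈ gradT ℬ n) : B.bracket c bra U V ∈ gradT ℬ (m + n + c) := by
  refine apply_apply_mem_of_words hU hV ?_
  rintro u v rfl rfl
  exact B.bracket_word_mem h u v

theorem bracket_swap_word (h : IsDGABAlgebra 1 c ℬ mul bra d) : ∀ u v : List (HomEl ℬ),
    B.bracket c bra (word u) (word v) =
      -sg K ((wordDeg u + c) * (wordDeg v + c)) • B.bracket c bra (word v) (word u)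
  | [], v => by simp [word_nil]
  | u, [] => by simp [word_nil]
  | x :: u, y :: v => by
    have hu := bracket_swap_word h u (y :: v)
    have hv := bracket_swap_word h (x :: u) v
    simp only [word_cons, wordDeg_cons] at hu hv ⊢
    rw [B.bracket_cons_cons x.2.2 (word_mem u) y.2.2, B.bracket_cons_cons y.2.2 (word_mem v) x.2.2,
      hu, hv, B.shuffle_comm (word_mem u) (word_mem v), h.bra_swap x.2.2 y.2.2]
    simp only [map_smul, LinearMap.smul_apply]
    match_scalars <;> simp only [mul_add, sg_add, sg_mul_self, mul_comm] <;> ring_nf <;>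
      simp [sg_pow]
  termination_by u v => u.length + v.length

theorem bracket_swap (h : IsDGABAlgebra 1 c ℬ mul bra d) (hU : U ∈ gradT ℬ m)
    (hV : V ∈ gradT ℬ n) :
    B.bracket c bra U V = -sg K ((m + c) * (n + c)) • B.bracket c bra V U := by
  refine eq_of_words₂ (g := -sg K ((m + c) * (n + c)) • (B.bracket c bra).flip) hU hV ?_
  rintro u v rfl rfl
  exact B.bracket_swap_word h u v

theorem bracket_shuffle_word (h : IsDGABAlgebra 1 c ℬ mul bra d) : ∀ u v w : List (HomEl ℬ),
    B.bracket c bra (word u) (B.shuffle (word v) (word w)) =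
      B.shuffle (B.bracket c bra (word u) (word v)) (word w) +
        sg K (wordDeg v * (wordDeg u + c)) •
          B.shuffle (word v) (B.bracket c bra (word u) (word w))
  | [], v, w => by simp [word_nil]
  | u, [], w => by simp [word_nil, wordDeg_nil]
  | u, v, [] => by simp [word_nil]
  | x :: u, y :: v, z :: w => by
    have hx := cons_mem x.2.2 (word_mem u)
    have hy := cons_mem y.2.2 (word_mem v)
    have hu := congrArg (cons (x.2 : A)) (bracket_shuffle_word h u (y :: v) (z :: w))
    have hv := congrArg (cons (y.2 : A)) (bracket_shuffle_word h (x :: u) v (z :: w))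
    have hw := congrArg (cons (z.2 : A)) (bracket_shuffle_word h (x :: u) (y :: v) w)
    simp only [word_cons, wordDeg_cons, B.shuffle_cons_cons y.2.2 (word_mem v) z.2.2,
      B.bracket_cons_cons x.2.2 (word_mem u) y.2.2, B.bracket_cons_cons x.2.2 (word_mem u) z.2.2,
      map_add, map_smul, LinearMap.add_apply, LinearMap.smul_apply] at hu hv hw ⊢
    rw [B.shuffle_cons_cons x.2.2 (B.bracket_mem h (word_mem u) hy) z.2.2,
      B.shuffle_cons_cons y.2.2 (B.bracket_mem h hx (word_mem v)) z.2.2,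
      B.shuffle_cons_cons (h.bra_mem x.2.2 y.2.2) (B.shuffle_mem (word_mem u) (word_mem v)) z.2.2,
      B.shuffle_cons_cons y.2.2 (word_mem v) x.2.2,
      B.shuffle_cons_cons y.2.2 (word_mem v) (h.bra_mem x.2.2 z.2.2),
      B.shuffle_assoc, B.shuffle_left_comm (word_mem u) hy]
    simp only [map_smul]
    -- The induction hypotheses account for the terms that begin with `x`, `y` or `z`; those that
    -- begin with a bracket of two letters agree on both sides.
    linear_combination (norm := skip) hu +
      sg K (y.1 * (c + (x.1 + wordDeg u))) • hv +
      (sg K (z.1 * (y.1 + wordDeg v)) * sg K (z.1 * (c + (x.1 + wordDeg u)))) • hw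
    simp only [mul_add, sg_add, mul_comm]
    match_scalars <;> ring_nf <;> simp [sg_pow]
  termination_by u v w => u.length + v.length + w.length

theorem bracket_shuffle (h : IsDGABAlgebra 1 c ℬ mul bra d) (hU : U ∈ gradT ℬ m)
    (hV : V ∈ gradT ℬ n) (hW : W ∈ gradT ℬ p) :
    B.bracket c bra U (B.shuffle V W) = B.shuffle (B.bracket c bra U V) W +
      sg K (n * (m + c)) • B.shuffle V (B.bracket c bra U W) := by
  refine eq_of_words (f := B.bracket c bra U ∘ₗ B.shuffle V)
    (g := B.shuffle (B.bracket c bra U V) +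
      sg K (n * (m + c)) • B.shuffle V ∘ₗ B.bracket c bra U) hW fun w _ => ?_
  refine eq_of_words₂ (f := (B.bracket c bra).compl₂ (B.shuffle.flip (word w)))
    (g := (B.bracket c bra).compr₂ (B.shuffle.flip (word w)) +
      sg K (n * (m + c)) • (B.shuffle.compl₂ ((B.bracket c bra).flip (word w))).flip) hU hV ?_
  rintro u v rfl rfl
  exact B.bracket_shuffle_word h u v w

theorem shuffle_bracket (h : IsDGABAlgebra 1 c ℬ mul bra d) (hU : U ∈ gradT ℬ m)
    (hV : V ∈ gradT ℬ n) (hW : W ∈ gradT ℬ p) :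
    B.bracket c bra (B.shuffle U V) W = B.shuffle U (B.bracket c bra V W) +
      sg K (n * (p + c)) • B.shuffle (B.bracket c bra U W) V := by
  rw [B.bracket_swap h (B.shuffle_mem hU hV) hW, B.bracket_shuffle h hW hU hV,
    B.bracket_swap h hW hU, B.bracket_swap h hW hV]
  simp only [map_smul, LinearMap.smul_apply]
  match_scalars <;> simp only [mul_add, sg_add, sg_mul_self, mul_comm] <;> ring_nf <;>
    simp [sg_pow]

set_option maxHeartbeats 400000 in
theorem bracket_bracket_word (h : IsDGABAlgebra 1 c ℬ mul bra d) : ∀ u v w : List (HomEl ℬ),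
    B.bracket c bra (word u) (B.bracket c bra (word v) (word w)) =
      B.bracket c bra (B.bracket c bra (word u) (word v)) (word w) +
        sg K ((wordDeg u + c) * (wordDeg v + c)) •
          B.bracket c bra (word v) (B.bracket c bra (word u) (word w))
  | [], v, w => by simp [word_nil]
  | u, [], w => by simp [word_nil]
  | u, v, [] => by simp [word_nil]
  | x :: u, y :: v, z :: w => by
    have hx := cons_mem x.2.2 (word_mem u)
    have hy := cons_mem y.2.2 (word_mem v)
    have hz := cons_mem z.2.2 (word_mem w)
    have hu := congrArg (cons (x.2 : A)) (bracket_bracket_word h u (y :: v) (z :: w))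
    have hv := congrArg (cons (y.2 : A)) (bracket_bracket_word h (x :: u) v (z :: w))
    have hw := congrArg (cons (z.2 : A)) (bracket_bracket_word h (x :: u) (y :: v) w)
    simp only [word_cons, wordDeg_cons, B.bracket_cons_cons y.2.2 (word_mem v) z.2.2,
      B.bracket_cons_cons x.2.2 (word_mem u) y.2.2, B.bracket_cons_cons x.2.2 (word_mem u) z.2.2,
      map_add, map_smul, LinearMap.add_apply, LinearMap.smul_apply] at hu hv hw ⊢
    rw [B.bracket_cons_cons x.2.2 (word_mem u) (h.bra_mem y.2.2 z.2.2),
      B.bracket_cons_cons x.2.2 (B.bracket_mem h (word_mem u) hy) z.2.2,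
      B.bracket_cons_cons y.2.2 (B.bracket_mem h hx (word_mem v)) z.2.2,
      B.bracket_cons_cons (h.bra_mem x.2.2 y.2.2) (B.shuffle_mem (word_mem u) (word_mem v)) z.2.2,
      B.bracket_cons_cons y.2.2 (word_mem v) x.2.2,
      B.bracket_cons_cons y.2.2 (word_mem v) (h.bra_mem x.2.2 z.2.2),
      B.bracket_shuffle h hx (word_mem v) (word_mem w),
      B.shuffle_bracket h (word_mem u) (word_mem v) hz,
      B.bracket_shuffle h hy (word_mem u) (word_mem w), B.bracket_swap h hy (word_mem u),
      B.shuffle_comm (word_mem v) (B.bracket_mem h (word_mem u) hz),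
      B.shuffle_assoc, B.shuffle_left_comm (word_mem u) (word_mem v),
      h.bra_bra x.2.2 y.2.2 z.2.2, h.bra_swap y.2.2 x.2.2]
    simp only [map_add, map_smul, LinearMap.add_apply, LinearMap.smul_apply]
    linear_combination (norm := skip) hu + sg K (y.1 * (c + (x.1 + wordDeg u))) • hv +
      (sg K (z.1 * (c + (y.1 + wordDeg v))) * sg K (z.1 * (c + (x.1 + wordDeg u)))) • hw
    simp only [mul_add, sg_add, sg_mul_self, mul_comm]
    match_scalars <;> ring_nf <;> simp [sg_pow]
  termination_by u v w => u.length + v.length + w.length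

theorem bracket_bracket (h : IsDGABAlgebra 1 c ℬ mul bra d) (hU : U ∈ gradT ℬ m)
    (hV : V ∈ gradT ℬ n) (hW : W ∈ gradT ℬ p) :
    B.bracket c bra U (B.bracket c bra V W) = B.bracket c bra (B.bracket c bra U V) W +
      sg K ((m + c) * (n + c)) • B.bracket c bra V (B.bracket c bra U W) := by
  refine eq_of_words (f := B.bracket c bra U ∘ₗ B.bracket c bra V)
    (g := B.bracket c bra (B.bracket c bra U V) +
      sg K ((m + c) * (n + c)) • B.bracket c bra V ∘ₗ B.bracket c bra U) hW fun w _ => ?_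
  refine eq_of_words₂ (f := (B.bracket c bra).compl₂ ((B.bracket c bra).flip (word w)))
    (g := (B.bracket c bra).compr₂ ((B.bracket c bra).flip (word w)) +
      sg K ((m + c) * (n + c)) •
        ((B.bracket c bra).compl₂ ((B.bracket c bra).flip (word w))).flip) hU hV ?_
  rintro u v rfl rfl
  exact B.bracket_bracket_word h u v w

/-! ### The differential -/

/-- `absorb` on a word in the basis letters. -/
noncomputable def absorbWord (mul : A →ₗ[K] A →ₗ[K] A) :
    List I → A →ₗ[K] TensorAlgebra K A →ₗ[K] TensorAlgebra K A
  | [] => 0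
  | k :: u => cons.compl₁₂ (mul.flip (B.letter k)) (B.shuffle (B.wordBasis u))

/-- The trilinear map with `absorb mul (x ⊗ U) z V = (z · x) ⊗ (U ⧢ V)` and `absorb mul 1 z V = 0`.
Its values at `V = 1` are the words in which the letter `z` has been multiplied into the first
letter. -/
@[irreducible] noncomputable def absorb (mul : A →ₗ[K] A →ₗ[K] A) :
    TensorAlgebra K A →ₗ[K] A →ₗ[K] TensorAlgebra K A →ₗ[K] TensorAlgebra K A :=
  B.wordBasis.constr K (B.absorbWord mul)

@[simp] theorem absorb_one (z : A) (V : TensorAlgebra K A) : B.absorb mul 1 z V = 0 := by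
  rw [← B.wordBasis_nil, absorb, Module.Basis.constr_basis, absorbWord, LinearMap.zero_apply,
    LinearMap.zero_apply]

theorem absorb_cons (x z : A) (U V : TensorAlgebra K A) :
    B.absorb mul (cons x U) z V = cons (mul z x) (B.shuffle U V) := by
  refine eqOn_span₂ (f := cons.compr₂ (((B.absorb mul).flip z).flip V))
    (g := cons.compl₁₂ (mul z) (B.shuffle.flip V)) ?_
    (B.letter.mem_span x) (B.wordBasis.mem_span U)
  rintro _ ⟨k, rfl⟩ _ ⟨u, rfl⟩
  simp [← wordBasis_cons, absorb, absorbWord, Module.Basis.constr_basis]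

theorem absorb_mem (h : IsDGABAlgebra 1 c ℬ mul bra d) (hU : U ∈ gradT ℬ m) (hz : z ∈ ℬ i)
    (hV : V ∈ gradT ℬ n) : B.absorb mul U z V ∈ gradT ℬ (i + m + n + 1) := by
  refine (Submodule.map_span_le (((B.absorb mul).flip z).flip V) _ _).2 ?_
    (Submodule.mem_map_of_mem hU)
  rintro _ ⟨_ | ⟨x, u⟩, rfl, rfl⟩
  · simp [word_nil]
  simp only [LinearMap.flip_apply, word_cons, absorb_cons]
  convert cons_mem (h.mul_mem hz x.2.2) (B.shuffle_mem (word_mem u) hV) using 2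
  rw [wordDeg_cons]
  ring

theorem absorb_one_mem (h : IsDGABAlgebra 1 c ℬ mul bra d) (hU : U ∈ gradT ℬ m) (hz : z ∈ ℬ i) :
    B.absorb mul U z 1 ∈ gradT ℬ (i + m + 1) := by
  simpa only [add_zero] using B.absorb_mem h hU hz one_mem_gradT

/-- The differential of a word in the basis letters. -/
noncomputable def diffWord (mul : A →ₗ[K] A →ₗ[K] A) (d : A →ₗ[K] A) : List I → TensorAlgebra K A
  | [] => 0
  | k :: u => cons (d (B.letter k)) (B.wordBasis u) + sg K (B.deg k) •
      (cons (B.letter k) (diffWord mul d u) + B.absorb mul (B.wordBasis u) (B.letter k) 1)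

/-- The coderivation of the tensor coalgebra that extends the differential and the product of
`A`. -/
@[irreducible] noncomputable def diff (mul : A →ₗ[K] A →ₗ[K] A) (d : A →ₗ[K] A) :
    TensorAlgebra K A →ₗ[K] TensorAlgebra K A :=
  B.wordBasis.constr K (B.diffWord mul d)

@[simp] theorem diff_one : B.diff mul d 1 = 0 := by
  rw [← B.wordBasis_nil, diff, Module.Basis.constr_basis, diffWord]

theorem diff_cons (hx : x ∈ ℬ i) (U : TensorAlgebra K A) :
    B.diff mul d (cons x U) =
      cons (d x) U + sg K i • (cons x (B.diff mul d U) + B.absorb mul U x 1) := by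
  rw [← B.span_letter] at hx
  refine eqOn_span₂ (f := cons.compr₂ (B.diff mul d))
    (g := cons ∘ₗ d + sg K i • (cons.compl₂ (B.diff mul d) +
      (((B.absorb mul).compr₂ (LinearMap.applyₗ 1)).flip))) ?_ hx (B.wordBasis.mem_span U)
  rintro _ ⟨k, rfl, rfl⟩ _ ⟨u, rfl⟩
  simp [← wordBasis_cons, diff, diffWord, Module.Basis.constr_basis]

theorem diff_word_mem (h : IsDGABAlgebra 1 c ℬ mul bra d) : ∀ u : List (HomEl ℬ),
    B.diff mul d (word u) ∈ gradT ℬ (wordDeg u + 1)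
  | [] => by simp [word_nil]
  | x :: u => by
    rw [word_cons, wordDeg_cons, B.diff_cons x.2.2]
    refine add_mem ?_ (Submodule.smul_mem _ _ (add_mem ?_ (B.absorb_one_mem h (word_mem u) x.2.2)))
    · convert cons_mem (h.d_mem x.2.2) (word_mem u) using 2
      ring
    · rw [add_assoc]
      exact cons_mem x.2.2 (diff_word_mem h u)

theorem diff_mem (h : IsDGABAlgebra 1 c ℬ mul bra d) (hU : U ∈ gradT ℬ m) :
    B.diff mul d U ∈ gradT ℬ (m + 1) := by
  refine (Submodule.map_span_le (B.diff mul d) _ _).2 ?_ (Submodule.mem_map_of_mem hU)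
  rintro _ ⟨u, rfl, rfl⟩
  exact B.diff_word_mem h u

theorem absorb_absorb (h : IsDGABAlgebra 1 c ℬ mul bra d) (x y : A) (hU : U ∈ gradT ℬ m) :
    B.absorb mul (B.absorb mul U y 1) x 1 = B.absorb mul U (mul x y) 1 := by
  refine eq_of_words
    (f := ((B.absorb mul).flip x).flip 1 ∘ₗ ((B.absorb mul).flip y).flip 1)
    (g := ((B.absorb mul).flip (mul x y)).flip 1) hU fun u _ => ?_
  cases u <;> simp [word_nil, word_cons, absorb_cons, h.mul_assoc]

theorem diff_absorb (h : IsDGABAlgebra 1 c ℬ mul bra d) (hx : x ∈ ℬ i) (hU : U ∈ gradT ℬ m) :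
    B.diff mul d (B.absorb mul U x 1) =
      B.absorb mul U (d x) 1 - sg K i • B.absorb mul (B.diff mul d U) x 1 := by
  refine eq_of_words (f := B.diff mul d ∘ₗ ((B.absorb mul).flip x).flip 1)
    (g := ((B.absorb mul).flip (d x)).flip 1 -
      sg K i • (((B.absorb mul).flip x).flip 1 ∘ₗ B.diff mul d)) hU fun u _ => ?_
  rcases u with _ | ⟨y, u⟩
  · simp [word_nil]
  simp only [LinearMap.comp_apply, LinearMap.sub_apply, LinearMap.smul_apply, LinearMap.flip_apply,
    word_cons, absorb_cons, shuffle_one]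
  rw [B.diff_cons (h.mul_mem hx y.2.2), B.diff_cons y.2.2, h.d_mul hx y.2.2,
    negOnePow_smul_eq_sg_smul (K := K)]
  simp only [map_add, map_smul, LinearMap.add_apply, LinearMap.smul_apply, absorb_cons,
    shuffle_one, B.absorb_absorb h x y.2 (word_mem u), sg_add, sg_one]
  module

theorem diff_diff_word (h : IsDGABAlgebra 1 c ℬ mul bra d) : ∀ u : List (HomEl ℬ),
    B.diff mul d (B.diff mul d (word u)) = 0
  | [] => by simp [word_nil]
  | x :: u => by
    simp only [word_cons, B.diff_cons x.2.2, map_add, map_smul, B.diff_cons (h.d_mem x.2.2),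
      B.diff_absorb h x.2.2 (word_mem u), h.d_d, map_zero, LinearMap.zero_apply, zero_add,
      diff_diff_word h u, sg_add, sg_one]
    module

theorem diff_diff (h : IsDGABAlgebra 1 c ℬ mul bra d) (hU : U ∈ gradT ℬ m) :
    B.diff mul d (B.diff mul d U) = 0 :=
  eq_of_words (f := B.diff mul d ∘ₗ B.diff mul d) (g := 0) hU fun u _ => B.diff_diff_word h u

theorem absorb_shuffle (z : A) (hU : U ∈ gradT ℬ m) (hV : V ∈ gradT ℬ n) :
    B.absorb mul (B.shuffle U V) z 1 = B.absorb mul U z V + sg K (m * n) • B.absorb mul V z U := by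
  refine eq_of_words₂ (f := B.shuffle.compr₂ (((B.absorb mul).flip z).flip 1))
    (g := (B.absorb mul).flip z + sg K (m * n) • ((B.absorb mul).flip z).flip) hU hV ?_
  rintro (_ | ⟨x, u⟩) (_ | ⟨y, v⟩) rfl rfl
  · simp [word_nil]
  · simp [word_nil, wordDeg_nil, word_cons, absorb_cons]
  · simp [word_nil, wordDeg_nil, word_cons, absorb_cons]
  simp only [LinearMap.compr₂_apply, LinearMap.add_apply, LinearMap.smul_apply,
    LinearMap.flip_apply, word_cons, wordDeg_cons]
  rw [B.shuffle_cons_cons x.2.2 (word_mem u) y.2.2]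
  simp only [map_add, map_smul, LinearMap.add_apply, LinearMap.smul_apply, absorb_cons, shuffle_one]
  rw [B.shuffle_comm (cons_mem x.2.2 (word_mem u)) (word_mem v), map_smul]
  simp only [mul_add, sg_add, mul_comm]
  match_scalars <;> ring_nf

theorem absorb_cons_right (h : IsDGABAlgebra 1 c ℬ mul bra d) (hU : U ∈ gradT ℬ m) (hz : z ∈ ℬ i)
    (hy : y ∈ ℬ j) :
    B.absorb mul U z (cons y V) = B.shuffle (B.absorb mul U z 1) (cons y V) -
      sg K (j * (i + m + 1)) • cons y (B.shuffle (B.absorb mul U z 1) V) := by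
  refine eq_of_words (f := ((B.absorb mul).flip z).flip (cons y V))
    (g := B.shuffle.flip (cons y V) ∘ₗ ((B.absorb mul).flip z).flip 1 -
      sg K (j * (i + m + 1)) • (cons y ∘ₗ B.shuffle.flip V ∘ₗ ((B.absorb mul).flip z).flip 1))
    hU ?_
  rintro (_ | ⟨x, u⟩) rfl
  · simp [word_nil]
  simp only [LinearMap.comp_apply, LinearMap.sub_apply, LinearMap.smul_apply, LinearMap.flip_apply,
    word_cons, wordDeg_cons, absorb_cons, shuffle_one]
  rw [B.shuffle_cons_cons (h.mul_mem hz x.2.2) (word_mem u) hy,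
    show i + x.1 + 1 + wordDeg u = i + (x.1 + wordDeg u) + 1 by ring, add_sub_cancel_right]

theorem diff_shuffle_word (h : IsDGABAlgebra 1 c ℬ mul bra d) : ∀ u v : List (HomEl ℬ),
    B.diff mul d (B.shuffle (word u) (word v)) =
      B.shuffle (B.diff mul d (word u)) (word v) +
        sg K (wordDeg u) • B.shuffle (word u) (B.diff mul d (word v))
  | [], v => by simp [word_nil, wordDeg_nil]
  | u, [] => by simp [word_nil]
  | x :: u, y :: v => by
    have hx := cons_mem x.2.2 (word_mem u)
    have hy := cons_mem y.2.2 (word_mem v)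
    have hvy := B.absorb_one_mem h (word_mem v) y.2.2
    have hu := congrArg (cons (x.2 : A)) (diff_shuffle_word h u (y :: v))
    have hv := congrArg (cons (y.2 : A)) (diff_shuffle_word h (x :: u) v)
    simp only [word_cons, wordDeg_cons, B.diff_cons x.2.2, B.diff_cons y.2.2,
      B.shuffle_cons_cons x.2.2 (word_mem u) y.2.2, B.absorb_shuffle _ (word_mem u) hy,
      B.absorb_shuffle _ hx (word_mem v), B.absorb_cons_right h (word_mem u) x.2.2 y.2.2,
      B.absorb_cons_right h (word_mem v) y.2.2 x.2.2, absorb_cons,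
      map_add, map_smul, LinearMap.add_apply, LinearMap.smul_apply] at hu hv ⊢
    rw [B.shuffle_comm hvy hx, B.shuffle_comm hvy (word_mem u),
      B.shuffle_cons_cons (h.d_mem x.2.2) (word_mem u) y.2.2,
      B.shuffle_cons_cons x.2.2 (B.diff_word_mem h u) y.2.2,
      B.shuffle_cons_cons x.2.2 (word_mem u) (h.d_mem y.2.2),
      B.shuffle_comm (word_mem v) (word_mem u), h.mul_comm y.2.2 x.2.2,
      negOnePow_smul_eq_sg_smul (K := K)]
    simp only [map_smul, LinearMap.smul_apply]
    linear_combination (norm := skip) sg K x.1 • hu +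
      (sg K (y.1 * (x.1 + wordDeg u)) * sg K y.1) • hv
    simp only [mul_add, sg_add, mul_comm, mul_one, sg_one]
    match_scalars <;> ring_nf <;> simp [sg_pow]
  termination_by u v => u.length + v.length

theorem diff_shuffle (h : IsDGABAlgebra 1 c ℬ mul bra d) (hU : U ∈ gradT ℬ m)
    (hV : V ∈ gradT ℬ n) :
    B.diff mul d (B.shuffle U V) =
      B.shuffle (B.diff mul d U) V + sg K m • B.shuffle U (B.diff mul d V) := by
  refine eq_of_words₂ (f := B.shuffle.compr₂ (B.diff mul d))
    (g := B.shuffle ∘ₗ B.diff mul d + sg K m • B.shuffle.compl₂ (B.diff mul d)) hU hV ?_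
  rintro u v rfl rfl
  exact B.diff_shuffle_word h u v

theorem absorb_bracket (h : IsDGABAlgebra 1 c ℬ mul bra d) (hU : U ∈ gradT ℬ m) (hx : x ∈ ℬ i)
    (hy : y ∈ ℬ j) (V : TensorAlgebra K A) :
    B.absorb mul (B.bracket c bra U (cons y V)) x 1 =
      B.bracket c bra (B.absorb mul U x 1) (cons y V) -
      sg K (j * (c + (i + m + 1))) • cons y (B.bracket c bra (B.absorb mul U x 1) V) +
      sg K (j * (c + m)) • cons (mul x y) (B.bracket c bra U V) -
      sg K ((m + 1) * (j + c)) • B.absorb mul U (bra x y) V := by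
  refine eq_of_words (f := ((B.absorb mul).flip x).flip 1 ∘ₗ (B.bracket c bra).flip (cons y V))
    (g := (B.bracket c bra).flip (cons y V) ∘ₗ ((B.absorb mul).flip x).flip 1 -
      sg K (j * (c + (i + m + 1))) •
        (cons y ∘ₗ (B.bracket c bra).flip V ∘ₗ ((B.absorb mul).flip x).flip 1) +
      sg K (j * (c + m)) • (cons (mul x y) ∘ₗ (B.bracket c bra).flip V) -
      sg K ((m + 1) * (j + c)) • ((B.absorb mul).flip (bra x y)).flip V) hU ?_
  rintro (_ | ⟨z, u⟩) rfl
  · simp [word_nil]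
  simp only [LinearMap.comp_apply, LinearMap.add_apply, LinearMap.sub_apply, LinearMap.smul_apply,
    LinearMap.flip_apply, word_cons, wordDeg_cons]
  rw [B.bracket_cons_cons z.2.2 (word_mem u) hy]
  simp only [map_add, map_smul, LinearMap.add_apply, LinearMap.smul_apply, absorb_cons, shuffle_one]
  rw [B.bracket_cons_cons (h.mul_mem hx z.2.2) (word_mem u) hy, h.bra_mul hx z.2.2 hy]
  simp only [map_add, map_smul, LinearMap.add_apply, LinearMap.smul_apply]
  match_scalars <;> simp only [mul_add, sg_add, mul_comm] <;> ring_nf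

set_option maxHeartbeats 800000 in
theorem diff_bracket_word (h : IsDGABAlgebra 1 c ℬ mul bra d) : ∀ u v : List (HomEl ℬ),
    B.diff mul d (B.bracket c bra (word u) (word v)) =
      B.bracket c bra (B.diff mul d (word u)) (word v) +
        sg K (wordDeg u + c) • B.bracket c bra (word u) (B.diff mul d (word v))
  | [], v => by simp [word_nil]
  | u, [] => by simp [word_nil]
  | x :: u, y :: v => by
    have hx := cons_mem x.2.2 (word_mem u)
    have hvx := B.absorb_one_mem h (word_mem v) y.2.2
    have hu := congrArg (cons (x.2 : A)) (diff_bracket_word h u (y :: v))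
    have hv := congrArg (cons (y.2 : A)) (diff_bracket_word h (x :: u) v)
    -- The terms in which `y` is multiplied into `x` come from `absorb_bracket` with the two words
    -- exchanged.
    have hxy := B.absorb_bracket h (word_mem v) y.2.2 x.2.2 (word u)
    rw [B.bracket_swap h (word_mem v) hx, B.bracket_swap h hvx hx,
      B.bracket_swap h hvx (word_mem u), B.bracket_swap h (word_mem v) (word_mem u),
      h.bra_swap y.2.2 x.2.2, h.mul_comm y.2.2 x.2.2, negOnePow_smul_eq_sg_smul (K := K)] at hxy
    simp only [word_cons, wordDeg_cons, B.diff_cons x.2.2, B.diff_cons y.2.2,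
      map_add, map_smul, LinearMap.add_apply, LinearMap.smul_apply] at hu hv hxy ⊢
    rw [B.bracket_cons_cons x.2.2 (word_mem u) y.2.2]
    simp only [map_add, map_smul, B.diff_cons x.2.2, B.diff_cons y.2.2,
      B.diff_cons (h.bra_mem x.2.2 y.2.2), B.absorb_bracket h (word_mem u) x.2.2 y.2.2,
      B.absorb_shuffle _ (word_mem u) (word_mem v), B.diff_shuffle h (word_mem u) (word_mem v),
      h.d_bra x.2.2 y.2.2, negOnePow_smul_eq_sg_smul (K := K), LinearMap.add_apply,
      LinearMap.smul_apply]
    rw [B.bracket_cons_cons (h.d_mem x.2.2) (word_mem u) y.2.2,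
      B.bracket_cons_cons x.2.2 (B.diff_word_mem h u) y.2.2,
      B.bracket_cons_cons x.2.2 (word_mem u) (h.d_mem y.2.2),
      B.bracket_cons_cons x.2.2 (word_mem u) y.2.2]
    linear_combination (norm := skip) sg K x.1 • hu +
      (sg K (y.1 * (c + (x.1 + wordDeg u))) * sg K y.1) • hv -
      (sg K (y.1 * (c + (x.1 + wordDeg u))) * sg K y.1 *
        sg K ((wordDeg v + c) * (x.1 + wordDeg u + c))) • hxy
    simp only [mul_add, mul_one, sg_add, sg_mul_self, mul_comm]
    match_scalars <;> ring_nf <;> simp [sg_pow]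
  termination_by u v => u.length + v.length

theorem diff_bracket (h : IsDGABAlgebra 1 c ℬ mul bra d) (hU : U ∈ gradT ℬ m)
    (hV : V ∈ gradT ℬ n) :
    B.diff mul d (B.bracket c bra U V) =
      B.bracket c bra (B.diff mul d U) V + sg K (m + c) • B.bracket c bra U (B.diff mul d V) := by
  refine eq_of_words₂ (f := (B.bracket c bra).compr₂ (B.diff mul d))
    (g := B.bracket c bra ∘ₗ B.diff mul d +
      sg K (m + c) • (B.bracket c bra).compl₂ (B.diff mul d)) hU hV ?_
  rintro u v rfl rfl
  exact B.diff_bracket_word h u v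

end HomogeneousBasis

/-! ### Shuffle permutations and Koszul signs -/

section Interleavings

variable {ι : Type*} {u v l : List ι}

/-- The interleavings (shuffles) of two lists. -/
def interleavings : List ι → List ι → List (List ι)
  | [], v => [v]
  | i :: u, [] => [i :: u]
  | i :: u, j :: v =>
    (interleavings u (j :: v)).map (i :: ·) ++ (interleavings (i :: u) v).map (j :: ·)

@[simp] theorem interleavings_nil_left (v : List ι) : interleavings [] v = [v] := by
  rw [interleavings]

@[simp] theorem interleavings_nil_right (u : List ι) : interleavings u [] = [u] := by
  cases u <;> simp [interleavings]

theorem cons_mem_interleavings_left (i : ι) (hl : l ∈ interleavings u v) :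
    i :: l ∈ interleavings (i :: u) v := by
  cases v <;> simp_all [interleavings]

theorem cons_mem_interleavings_right (j : ι) (hl : l ∈ interleavings u v) :
    j :: l ∈ interleavings u (j :: v) := by
  cases u <;> simp_all [interleavings]

theorem mem_interleavings_filter (p : ι → Prop) [DecidablePred p] (l : List ι) :
    l ∈ interleavings (l.filter (p ·)) (l.filter (¬p ·)) := by
  induction l with
  | nil => simp
  | cons i l ih =>
    by_cases hi : p i
    · simpa [hi] using cons_mem_interleavings_left i ih
    · simpa [hi] using cons_mem_interleavings_right i ih

theorem perm_of_mem_interleavings : ∀ {u v l : List ι}, l ∈ interleavings u v → l.Perm (u ++ v)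
  | [], v, l, h => by simp_all
  | i :: u, [], l, h => by simp_all
  | i :: u, j :: v, l, h => by
    rw [interleavings, List.mem_append, List.mem_map, List.mem_map] at h
    rcases h with ⟨l, hl, rfl⟩ | ⟨l, hl, rfl⟩
    · exact (perm_of_mem_interleavings hl).cons i
    · exact ((perm_of_mem_interleavings hl).cons j).trans List.perm_middle.symm

theorem sublist_of_mem_interleavings : ∀ {u v l : List ι},
    l ∈ interleavings u v → u.Sublist l ∧ v.Sublist l
  | [], v, l, h => by simp_all
  | i :: u, [], l, h => by simp_all
  | i :: u, j :: v, l, h => by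
    rw [interleavings, List.mem_append, List.mem_map, List.mem_map] at h
    rcases h with ⟨l, hl, rfl⟩ | ⟨l, hl, rfl⟩
    · exact ⟨(sublist_of_mem_interleavings hl).1.cons_cons i,
        (sublist_of_mem_interleavings hl).2.cons i⟩
    · exact ⟨(sublist_of_mem_interleavings hl).1.cons j,
        (sublist_of_mem_interleavings hl).2.cons_cons j⟩

theorem nodup_interleavings : ∀ {u v : List ι}, u.Disjoint v → (interleavings u v).Nodup
  | [], v, _ => by simp
  | i :: u, [], _ => by simp
  | i :: u, j :: v, h => by
    have hij : i ≠ j := by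
      rintro rfl
      exact h List.mem_cons_self List.mem_cons_self
    rw [interleavings, List.nodup_append]
    refine ⟨(nodup_interleavings (List.disjoint_of_disjoint_cons_left h)).map List.cons_injective,
      (nodup_interleavings (List.disjoint_of_disjoint_cons_right h)).map List.cons_injective, ?_⟩
    rintro _ hi _ hj rfl
    obtain ⟨_, _, rfl⟩ := List.mem_map.1 hi
    obtain ⟨_, _, h'⟩ := List.mem_map.1 hj
    exact hij (List.cons.inj h').1.symm

theorem filter_eq_of_pairwise {R : ι → ι → Prop} [Std.Asymm R] {p : ι → Prop} [DecidablePred p]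
    (hl : l.Pairwise R) (hu : u.Pairwise R) (h : ∀ i, i ∈ u ↔ i ∈ l ∧ p i) :
    l.filter (p ·) = u := by
  have hne : ∀ {i j : ι}, R i j → i ≠ j := fun h => by
    rintro rfl
    exact Std.Asymm.asymm _ _ h h
  refine List.Perm.eq_of_pairwise (fun a b _ _ h₁ h₂ => absurd h₁ (Std.Asymm.asymm _ _ h₂))
    (hl.filter _) hu ?_
  rw [List.perm_ext_iff_of_nodup ((hl.imp hne).filter _) (hu.imp hne)]
  simp [h]

theorem exists_ofFn_perm_eq {n : ℕ} {l : List (Fin n)} (hl : l.Nodup) (hn : l.length = n) :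
    ∃ σ : Equiv.Perm (Fin n), List.ofFn σ = l := by
  have hinj : Function.Injective fun i : Fin n => l.get (i.cast hn.symm) :=
    hl.injective_get.comp (Fin.cast_injective _)
  refine ⟨Equiv.ofBijective _ (Finite.injective_iff_bijective.1 hinj), ?_⟩
  exact List.ext_get (by simp [hn]) fun k h₁ h₂ => by simp

end Interleavings

section Bat

variable {p q : ℕ}

theorem mem_Bat_iff_pairwise (σ : Equiv.Perm (Fin (p + q))) : σ ∈ Bat p q ↔
    (List.ofFn (Fin.castAdd (n := p) q)).Pairwise (fun i j => σ i < σ j) ∧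
      (List.ofFn (Fin.natAdd (m := q) p)).Pairwise (fun i j => σ i < σ j) := by
  simp only [Bat, Finset.mem_filter, Finset.mem_univ, true_and, List.pairwise_ofFn]
  refine and_congr ⟨fun h i j hij => h _ _ hij j.2, fun h => ?_⟩
    ⟨fun h i j hij => h _ _ (by simpa) (by simp), fun h => ?_⟩
  · intro i j hij hj
    exact h (i := ⟨i, lt_trans (by simpa) hj⟩) (j := ⟨j, hj⟩) hij
  · intro i j hij hi
    obtain ⟨i, rfl⟩ : i ∈ Set.range (Fin.natAdd (m := q) p) := by rwa [Fin.range_natAdd]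
    obtain ⟨j, rfl⟩ : j ∈ Set.range (Fin.natAdd (m := q) p) := by
      rw [Fin.range_natAdd]
      exact hi.trans hij.le
    exact h ((Fin.strictMono_natAdd p).lt_iff_lt.1 hij)

theorem disjoint_castAdd_natAdd :
    (List.ofFn (Fin.castAdd (n := p) q)).Disjoint (List.ofFn (Fin.natAdd p)) := by
  intro i hi hj
  obtain ⟨i, rfl⟩ := List.mem_ofFn.1 hi
  obtain ⟨j, hj⟩ := List.mem_ofFn.1 hj
  rw [Fin.ext_iff, Fin.val_natAdd, Fin.val_castAdd] at hj
  omega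

theorem mem_Bat_iff (σ : Equiv.Perm (Fin (p + q))) : σ ∈ Bat p q ↔
    List.ofFn ⇑σ⁻¹ ∈ interleavings (List.ofFn (Fin.castAdd q)) (List.ofFn (Fin.natAdd p)) := by
  have hσ : (List.ofFn ⇑σ⁻¹).Pairwise fun i j => σ i < σ j := by simp [List.pairwise_ofFn]
  have hmem (i : Fin (p + q)) : i ∈ List.ofFn ⇑σ⁻¹ := List.mem_ofFn.2 ⟨σ i, by simp⟩
  have : Std.Asymm fun i j => σ i < σ j := ⟨fun _ _ h => h.asymm⟩
  rw [mem_Bat_iff_pairwise]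
  refine ⟨fun ⟨hu, hv⟩ => ?_, fun h => ?_⟩
  · rw [← filter_eq_of_pairwise (p := fun i : Fin (p + q) => (i : ℕ) < p) hσ hu,
      ← filter_eq_of_pairwise (p := fun i : Fin (p + q) => ¬(i : ℕ) < p) hσ hv]
    · exact mem_interleavings_filter _ _
    · intro i
      simp only [hmem, true_and, List.mem_ofFn, ← Set.mem_range, Fin.range_natAdd]
      simp
    · intro i
      simp only [hmem, true_and, List.mem_ofFn, ← Set.mem_range, Fin.range_castLE, Fin.castAdd]
      simp
  · exact ⟨hσ.sublist (sublist_of_mem_interleavings h).1,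
      hσ.sublist (sublist_of_mem_interleavings h).2⟩

theorem sum_Bat {N : Type*} [AddCommMonoid N] (F : List (Fin (p + q)) → N) :
    ∑ σ ∈ Bat p q, F (List.ofFn ⇑σ⁻¹) =
      ((interleavings (List.ofFn (Fin.castAdd q)) (List.ofFn (Fin.natAdd p))).map F).sum := by
  rw [← List.sum_toFinset _ (nodup_interleavings disjoint_castAdd_natAdd)]
  refine Finset.sum_bij (fun σ _ => List.ofFn ⇑σ⁻¹) (fun σ hσ => ?_) (fun σ _ τ _ h => ?_)
    (fun l hl => ?_) (fun _ _ => rfl)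
  · exact List.mem_toFinset.2 ((mem_Bat_iff σ).1 hσ)
  · exact inv_injective (DFunLike.coe_injective (List.ofFn_injective h))
  · rw [List.mem_toFinset] at hl
    have hperm := perm_of_mem_interleavings hl
    have hnodup : l.Nodup := hperm.nodup_iff.2 <| List.nodup_append'.2
      ⟨List.nodup_ofFn.2 (Fin.castAdd_injective p q), List.nodup_ofFn.2 (Fin.natAdd_injective q p),
        disjoint_castAdd_natAdd⟩
    obtain ⟨σ, rfl⟩ := exists_ofFn_perm_eq hnodup (by simpa using hperm.length_eq)
    exact ⟨σ⁻¹, (mem_Bat_iff _).2 (by rwa [inv_inv]), by rw [inv_inv]⟩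

end Bat

section KoszulSign

variable {ι : Type*} [LinearOrder ι] (w : ι → HomEl ℬ) {i j : ι} {u v l : List ι}

/-- The sign `∏ (-1)^{|w i| |w j|}` over the pairs of entries of `l` that are out of order. -/
def koszulSign : List ι → K
  | [] => 1
  | i :: l => (l.map fun j => if j < i then sg K ((w i).1 * (w j).1) else 1).prod * koszulSign l

theorem koszulSign_ofFn : ∀ {n : ℕ} (π : Fin n → ι), koszulSign w (List.ofFn π) =
    ∏ s, ∏ t, if s < t ∧ π t < π s then sg K ((w (π s)).1 * (w (π t)).1) else 1
  | 0, π => by simp [koszulSign]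
  | n + 1, π => by
    rw [List.ofFn_succ, koszulSign, koszulSign_ofFn, Fin.prod_univ_succ, Fin.prod_univ_succ]
    simp only [Fin.prod_univ_succ, lt_irrefl, false_and, if_false, one_mul, Fin.succ_pos, true_and,
      Fin.not_lt_zero, Fin.succ_lt_succ_iff, List.map_ofFn, List.prod_ofFn, Function.comp]

theorem prod_inversions_eq_one (h : ∀ j ∈ l, i < j) :
    (l.map fun j => if j < i then sg K ((w i).1 * (w j).1) else 1).prod = 1 := by
  refine List.prod_eq_one fun x hx => ?_
  obtain ⟨j, hj, rfl⟩ := List.mem_map.1 hx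
  rw [if_neg (h j hj).asymm]

theorem prod_inversions_eq_sg (h : ∀ i ∈ l, i < j) :
    (l.map fun i => if i < j then sg K ((w j).1 * (w i).1) else 1).prod =
      sg K ((w j).1 * wordDeg (l.map w)) := by
  induction l with
  | nil => simp [wordDeg_nil]
  | cons i l ih =>
    rw [List.map_cons, List.prod_cons, if_pos (h i (by simp)), ih (fun k hk => h k (by simp [hk])),
      List.map_cons, wordDeg_cons, mul_add, sg_add]

theorem koszulSign_of_pairwise (h : l.Pairwise (· < ·)) : koszulSign w l = 1 := by
  induction h with
  | nil => rfl
  | cons h _ ih => rw [koszulSign, ih, prod_inversions_eq_one w h, one_mul]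

theorem koszulSign_cons_left (hl : l ∈ interleavings u v) (h : (i :: (u ++ v)).Pairwise (· < ·)) :
    koszulSign w (i :: l) = koszulSign w l := by
  rw [koszulSign, prod_inversions_eq_one, one_mul]
  intro j hj
  exact List.rel_of_pairwise_cons h ((perm_of_mem_interleavings hl).mem_iff.1 hj)

theorem koszulSign_cons_right (hl : l ∈ interleavings u v) (h : (u ++ j :: v).Pairwise (· < ·)) :
    koszulSign w (j :: l) = sg K ((w j).1 * wordDeg (u.map w)) * koszulSign w l := by
  rw [koszulSign, ((perm_of_mem_interleavings hl).map _).prod_eq, List.map_append,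
    List.prod_append]
  rw [List.pairwise_append, List.pairwise_cons] at h
  rw [prod_inversions_eq_one w h.2.1.1, mul_one,
    prod_inversions_eq_sg w fun i hi => h.2.2 i hi j (by simp)]

/-- The sum of the values of `F` on the interleavings of two lists, weighted by Koszul signs. -/
def shuffleSum {N : Type*} [AddCommGroup N] [Module K N] (F : List ι → N) (u v : List ι) : N :=
  ((interleavings u v).map fun l => koszulSign w l • F l).sum

variable {N : Type*} [AddCommGroup N] [Module K N] {F G : List ι → N}

theorem shuffleSum_eq_zero (h : ∀ l ∈ interleavings u v, F l = 0) : shuffleSum w F u v = 0 := by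
  refine List.sum_eq_zero fun x hx => ?_
  obtain ⟨l, hl, rfl⟩ := List.mem_map.1 hx
  rw [h l hl, smul_zero]

theorem shuffleSum_add : shuffleSum w (fun l => F l + G l) u v =
    shuffleSum w F u v + shuffleSum w G u v := by
  simp only [shuffleSum, smul_add, List.sum_map_add]

theorem shuffleSum_map {P : Type*} [AddCommGroup P] [Module K P] (f : N →ₗ[K] P) :
    shuffleSum w (fun l => f (F l)) u v = f (shuffleSum w F u v) := by
  simp only [shuffleSum, map_list_sum, List.map_map, Function.comp_def, map_smul]

theorem shuffleSum_nil_left (h : v.Pairwise (· < ·)) : shuffleSum w F [] v = F v := by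
  simp [shuffleSum, koszulSign_of_pairwise w h]

theorem shuffleSum_nil_right (h : u.Pairwise (· < ·)) : shuffleSum w F u [] = F u := by
  simp [shuffleSum, koszulSign_of_pairwise w h]

theorem shuffleSum_cons_cons (h : (i :: u ++ j :: v).Pairwise (· < ·)) :
    shuffleSum w F (i :: u) (j :: v) = shuffleSum w (fun l => F (i :: l)) u (j :: v) +
      sg K ((w j).1 * ((w i).1 + wordDeg (u.map w))) •
        shuffleSum w (fun l => F (j :: l)) (i :: u) v := by
  rw [shuffleSum, interleavings, List.map_append, List.sum_append, List.map_map, List.map_map,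
    shuffleSum, shuffleSum, List.smul_sum, List.map_map]
  congr 2
  · exact List.map_congr_left fun l hl => by
      rw [Function.comp_apply, koszulSign_cons_left w hl h]
  · exact List.map_congr_left fun l hl => by
      rw [Function.comp_apply, Function.comp_apply, koszulSign_cons_right w hl h, smul_smul,
        List.map_cons, wordDeg_cons]

end KoszulSign

section MergeSum

variable {ι : Type*}

/-- The signed sum of the words obtained by applying `d` to one letter. -/
def letterSum (d : A →ₗ[K] A) : List (HomEl ℬ) → TensorAlgebra K A
  | [] => 0
  | x :: u => cons (d x.2) (word u) + sg K x.1 • cons (x.2 : A) (letterSum d u)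

/-- The word obtained by merging the letter `i` with the letter following it, if there is one. -/
def mergeFirst (w : ι → HomEl ℬ) (m : ι → ι → A) (i : ι) : List ι → TensorAlgebra K A
  | [] => 0
  | j :: l => cons (m i j) (word (l.map w))

/-- The signed sum of the words obtained by merging two adjacent letters. -/
def mergeSum (c : ℤ) (w : ι → HomEl ℬ) (m : ι → ι → A) : List ι → TensorAlgebra K A
  | [] => 0
  | i :: l => mergeFirst w m i l + sg K (c * (w i).1) • cons ((w i).2 : A) (mergeSum c w m l)

variable {c : ℤ} {w : ι → HomEl ℬ} {m : ι → ι → A} {i j : ι} {u v l : List ι}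

theorem mergeFirst_eq_zero (h : ∀ j ∈ l, m i j = 0) : mergeFirst w m i l = 0 := by
  cases l with
  | nil => rfl
  | cons j l => simp [mergeFirst, h j]

theorem mergeSum_eq_zero (h : ∀ i ∈ l, ∀ j ∈ l, m i j = 0) : mergeSum c w m l = 0 := by
  induction l with
  | nil => rfl
  | cons i l ih =>
    rw [mergeSum, mergeFirst_eq_zero fun j hj => h i (by simp) j (by simp [hj]),
      ih fun i hi j hj => h i (by simp [hi]) j (by simp [hj])]
    simp

theorem shuffleSum_mergeSum_cons [LinearOrder ι] :
    shuffleSum w (fun l => mergeSum c w m (i :: l)) u v = shuffleSum w (mergeFirst w m i) u v +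
      sg K (c * (w i).1) • cons ((w i).2 : A) (shuffleSum w (mergeSum c w m) u v) := by
  rw [← LinearMap.smul_apply, ← shuffleSum_map, ← shuffleSum_add]
  rfl

namespace HomogeneousBasis

variable {I : Type*} (B : HomogeneousBasis ℬ I) {mul bra : A →ₗ[K] A →ₗ[K] A} {d : A →ₗ[K] A}

theorem diff_word (w : ι → HomEl ℬ) (u : List ι) : B.diff mul d (word (u.map w)) =
    letterSum d (u.map w) + mergeSum 1 w (fun i j => sg K (w i).1 • mul (w i).2 (w j).2) u := by
  induction u with
  | nil => simp [word_nil, letterSum, mergeSum]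
  | cons i u ih =>
    rw [List.map_cons, word_cons, B.diff_cons (w i).2.2, ih, letterSum, mergeSum]
    cases u with
    | nil => simp [letterSum, mergeSum, mergeFirst, word_nil]
    | cons j u =>
      simp only [mergeFirst, List.map_cons, word_cons, absorb_cons, shuffle_one, one_mul, map_add,
        map_smul, LinearMap.smul_apply]
      module

variable [LinearOrder ι]

theorem shuffleSum_word : ∀ {u v : List ι}, (u ++ v).Pairwise (· < ·) →
    shuffleSum w (fun l => word (l.map w)) u v = B.shuffle (word (u.map w)) (word (v.map w))
  | [], v, h => by
    rw [shuffleSum_nil_left w (by simpa using h), List.map_nil, word_nil, one_shuffle]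
  | u, [], h => by
    rw [shuffleSum_nil_right w (by simpa using h), List.map_nil, word_nil, shuffle_one]
  | i :: u, j :: v, h => by
    have h' : (i :: u ++ v).Pairwise (· < ·) :=
      h.sublist ((List.sublist_cons_self j v).append_left _)
    have hleft := shuffleSum_word h.of_cons
    have hright := shuffleSum_word h'
    simp only [List.map_cons, word_cons] at hleft hright
    simp only [shuffleSum_cons_cons w h, List.map_cons, word_cons,
      B.shuffle_cons_cons (w i).2.2 (word_mem _) (w j).2.2, ← hleft, ← hright, shuffleSum_map]

theorem shuffleSum_mergeFirst (hu : ∀ k ∈ u, m i k = 0) (h : (u ++ j :: v).Pairwise (· < ·)) :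
    shuffleSum w (mergeFirst w m i) u (j :: v) = sg K ((w j).1 * wordDeg (u.map w)) •
      cons (m i j) (B.shuffle (word (u.map w)) (word (v.map w))) := by
  have h' : (u ++ v).Pairwise (· < ·) := h.sublist ((List.sublist_cons_self j v).append_left _)
  rw [← B.shuffleSum_word h', ← shuffleSum_map]
  cases u with
  | nil =>
    rw [List.nil_append] at h h'
    simp [shuffleSum_nil_left w h, shuffleSum_nil_left w h', mergeFirst, wordDeg_nil]
  | cons k u =>
    rw [shuffleSum_cons_cons w h, List.map_cons, wordDeg_cons]
    simp [mergeFirst, hu k, shuffleSum_eq_zero]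

theorem shuffleSum_mergeSum : ∀ {u v : List ι},
    (∀ i ∈ u, ∀ k ∈ u, m i k = 0) → (∀ j ∈ v, ∀ i, m j i = 0) →
    (∀ i ∈ u, ∀ j ∈ v, m i j = sg K (c * (w i).1) • bra (w i).2 (w j).2) →
    (u ++ v).Pairwise (· < ·) →
    shuffleSum w (mergeSum c w m) u v =
      sg K (c * wordDeg (u.map w)) • B.bracket c bra (word (u.map w)) (word (v.map w))
  | [], v, _, hv, _, h => by
    rw [shuffleSum_nil_left w (by simpa using h), mergeSum_eq_zero fun i hi j _ => hv i hi j]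
    simp [word_nil]
  | u, [], hu, _, _, h => by
    rw [shuffleSum_nil_right w (by simpa using h), mergeSum_eq_zero hu]
    simp [word_nil]
  | i :: u, j :: v, hu, hv, huv, h => by
    have h' : (i :: u ++ v).Pairwise (· < ·) :=
      h.sublist ((List.sublist_cons_self j v).append_left _)
    have hleft := shuffleSum_mergeSum (fun k hk l hl => hu k (by simp [hk]) l (by simp [hl])) hv
      (fun k hk => huv k (by simp [hk])) h.of_cons
    have hright := shuffleSum_mergeSum hu (fun k hk => hv k (by simp [hk]))
      (fun k hk l hl => huv k hk l (by simp [hl])) h'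
    have hfirst := B.shuffleSum_mergeFirst (w := w)
      (fun k hk => hu i (by simp) k (by simp [hk])) h.of_cons
    have hzero : shuffleSum w (mergeFirst w m j) (i :: u) v = 0 :=
      shuffleSum_eq_zero w fun l _ => mergeFirst_eq_zero fun k _ => hv j (by simp) k
    rw [shuffleSum_cons_cons w h, shuffleSum_mergeSum_cons, shuffleSum_mergeSum_cons, hleft,
      hright, hfirst, hzero, huv i (by simp) j (by simp)]
    simp only [List.map_cons, word_cons, wordDeg_cons, map_smul, LinearMap.smul_apply,
      B.bracket_cons_cons (w i).2.2 (word_mem _) (w j).2.2, mul_add, add_mul, sg_add, mul_comm]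
    match_scalars <;> ring_nf
    simp [sg_pow]

end HomogeneousBasis

end MergeSum

section Positions

variable {n : ℕ}

theorem tens_zero_letter (l l' : List A) : tens K (l ++ 0 :: l') = 0 := by
  simp [tens]

theorem degBefore_zero (a : ℤ) (w : Fin (n + 1) → HomEl 𝒜) : degBefore a w 0 = 0 := by
  rw [degBefore, ← bot_eq_zero, Finset.Iio_bot, Finset.sum_empty]

theorem degBefore_succ (a : ℤ) (w : Fin (n + 1) → HomEl 𝒜) (k : Fin n) :
    degBefore a w k.succ = dg a (w 0) + degBefore a (Fin.tail w) k := by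
  simp only [degBefore, ← Finset.filter_gt_eq_Iio, Finset.sum_filter, Fin.sum_univ_succ]
  simp [Fin.tail]

theorem tens_splice_zero (w : Fin (n + 1) → HomEl 𝒜) (r : ℕ) (x : A) :
    tens K (splice w 0 r x) = cons x (tens K ((letters w).drop r)) := by
  simp [splice, tens_cons]

theorem tens_splice_succ (w : Fin (n + 1) → HomEl 𝒜) (k r : ℕ) (x : A) :
    tens K (splice w (k + 1) r x) = cons ((w 0).2 : A) (tens K (splice (Fin.tail w) k r x)) := by
  rw [← tens_cons]
  simp [splice, letters, Fin.tail, Nat.add_right_comm]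

/-- A homogeneous element of `A` as a homogeneous element of the shifted space `A[-a+1]`. -/
def shiftEl (a : ℤ) (x : HomEl 𝒜) : HomEl (shift (1 - a) 𝒜) :=
  ⟨dg a x, x.2, by
    have := x.2.2
    rwa [shift, show dg a x + (1 - a) = x.1 by rw [dg]; ring]⟩

theorem word_ofFn (a : ℤ) (w : Fin n → HomEl 𝒜) :
    word (List.ofFn fun i => shiftEl a (w i)) = tens K (letters w) := by
  rw [word, List.map_ofFn]
  rfl

theorem wordDeg_ofFn (a : ℤ) (w : Fin n → HomEl 𝒜) :
    wordDeg (List.ofFn fun i => shiftEl a (w i)) = degWord a w := by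
  rw [wordDeg, List.map_ofFn, List.sum_ofFn]
  rfl

theorem sum_splice_one (a : ℤ) (d : A →ₗ[K] A) : ∀ {n : ℕ} (w : Fin n → HomEl 𝒜),
    ∑ k : Fin n, (degBefore a w k).negOnePow • tens K (splice w k 1 (d (w k).2)) =
      letterSum d (List.ofFn fun i => shiftEl a (w i))
  | 0, w => by simp [letterSum]
  | n + 1, w => by
    rw [Fin.sum_univ_succ, List.ofFn_succ, letterSum]
    congr 1
    · rw [degBefore_zero, Int.negOnePow_zero, one_smul, Fin.val_zero, tens_splice_zero, word_ofFn,
        letters, List.ofFn_succ]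
      rfl
    · rw [← sum_splice_one, map_sum, Finset.smul_sum]
      refine Finset.sum_congr rfl fun k _ => ?_
      simp only [degBefore_succ, Fin.val_succ, tens_splice_succ, negOnePow_smul_eq_sg_smul (K := K),
        sg_add, mul_smul, map_smul]
      rfl

theorem sum_adjacent_succ {N : Type*} [AddCommMonoid N] (F : Fin (n + 2) × Fin (n + 2) → N) :
    ∑ k with (k.2 : ℕ) = k.1 + 1, F k =
      F (0, 1) + ∑ k : Fin (n + 1) × Fin (n + 1) with (k.2 : ℕ) = k.1 + 1,
        F (k.1.succ, k.2.succ) := by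
  simp only [Finset.sum_filter, Fintype.sum_prod_type]
  rw [Fin.sum_univ_succ]
  congr 1
  · rw [Fin.sum_univ_succ, Fin.sum_univ_succ]
    simp
  · refine Finset.sum_congr rfl fun k _ => ?_
    rw [Fin.sum_univ_succ]
    simp

theorem sum_splice_two {ι : Type*} (a c : ℤ) (w : ι → HomEl 𝒜) (m : ι → ι → A) :
    ∀ {n : ℕ} (π : Fin n → ι),
    ∑ k : Fin n × Fin n with (k.2 : ℕ) = k.1 + 1,
      (c * degBefore a (w ∘ π) k.1).negOnePow •
        tens K (splice (w ∘ π) k.1 2 (m (π k.1) (π k.2))) =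
      mergeSum c (fun i => shiftEl a (w i)) m (List.ofFn π)
  | 0, π => by simp [mergeSum]
  | 1, π => by
    rw [Finset.sum_eq_zero]
    · simp [mergeSum, mergeFirst]
    · rintro ⟨i, j⟩ h
      simp at h
  | n + 2, π => by
    rw [sum_adjacent_succ, List.ofFn_succ, mergeSum, ← sum_splice_two]
    congr 1
    · have htail := word_ofFn a fun i : Fin n => w (π i.succ.succ)
      rw [degBefore_zero, mul_zero, Int.negOnePow_zero, one_smul, Fin.val_zero, tens_splice_zero,
        List.ofFn_succ, mergeFirst, List.map_ofFn, letters, List.ofFn_succ, List.ofFn_succ]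
      exact congrArg _ htail.symm
    · rw [map_sum, Finset.smul_sum]
      refine Finset.sum_congr rfl fun k _ => ?_
      simp only [degBefore_succ, Fin.val_succ, tens_splice_succ, negOnePow_smul_eq_sg_smul (K := K),
        mul_add, sg_add, mul_smul, map_smul]
      rfl

end Positions

section Factor

variable {M N Q : Type*} [AddCommGroup M] [Module K M] [AddCommGroup N] [Module K N]
  [AddCommGroup Q] [Module K Q] {f : M →ₗ[K] Q}

theorem exists_factor (hf : Function.Surjective f) (F : M →ₗ[K] N)
    (h : LinearMap.ker f ≤ LinearMap.ker F) : ∃ G : Q →ₗ[K] N, ∀ x, G (f x) = F x := by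
  obtain ⟨s, hs⟩ := f.exists_rightInverse_of_surjective (LinearMap.range_eq_top.2 hf)
  refine ⟨F ∘ₗ s, fun x => LinearMap.sub_mem_ker_iff.1 (h (LinearMap.sub_mem_ker_iff.2 ?_))⟩
  exact LinearMap.congr_fun hs (f x)

theorem exists_factor₂ (hf : Function.Surjective f) (F : M →ₗ[K] M →ₗ[K] N)
    (hleft : LinearMap.ker f ≤ LinearMap.ker F)
    (hright : LinearMap.ker f ≤ LinearMap.ker F.flip) :
    ∃ G : Q →ₗ[K] Q →ₗ[K] N, ∀ x y, G (f x) (f y) = F x y := by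
  obtain ⟨s, hs⟩ := f.exists_rightInverse_of_surjective (LinearMap.range_eq_top.2 hf)
  have hmem (x : M) : s (f x) - x ∈ LinearMap.ker f :=
    LinearMap.sub_mem_ker_iff.2 (LinearMap.congr_fun hs (f x))
  refine ⟨F.compl₁₂ s s, fun x y => ?_⟩
  have hx : F (s (f x)) = F x := LinearMap.sub_mem_ker_iff.1 (hleft (hmem x))
  have hy : F.flip (s (f y)) = F.flip y := LinearMap.sub_mem_ker_iff.1 (hright (hmem y))
  rw [LinearMap.compl₁₂_apply, hx]
  exact LinearMap.congr_fun hy x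

end Factor

/-! ### The quotient map onto `H` -/

section ToH

open TensorAlgebra (algebraMapInv)

variable (K A) in
/-- The projection of the tensor algebra along the scalars. -/
def projPlus : TensorAlgebra K A →ₗ[K] TensorAlgebra K A :=
  LinearMap.id - Algebra.linearMap K _ ∘ₗ algebraMapInv.toLinearMap

theorem projPlus_apply (t : TensorAlgebra K A) :
    projPlus K A t = t - algebraMap K _ (algebraMapInv t) := rfl

theorem projPlus_one : projPlus K A 1 = 0 := by
  simp [projPlus_apply]

theorem algebraMapInv_of_mem_Tplus {t : TensorAlgebra K A} (ht : t ∈ Tplus K A) :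
    algebraMapInv t = 0 := by
  have hle : Tplus K A ≤ LinearMap.ker (algebraMapInv (R := K) (M := A)).toLinearMap := by
    refine iSup_le fun n => ?_
    rw [pow_succ, Submodule.mul_le]
    rintro x _ _ ⟨y, rfl⟩
    simp [algebraMapInv]
  exact hle ht

theorem projPlus_of_mem {t : TensorAlgebra K A} (ht : t ∈ Tplus K A) : projPlus K A t = t := by
  rw [projPlus_apply, algebraMapInv_of_mem_Tplus ht, map_zero, sub_zero]

theorem projPlus_mem (t : TensorAlgebra K A) : projPlus K A t ∈ Tplus K A := by
  have ht : t ∈ ⨆ n : ℕ, LinearMap.range (TensorAlgebra.ι K (M := A)) ^ n := by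
    rw [(DirectSum.Decomposition.isInternal _).submodule_iSup_eq_top]
    trivial
  induction ht using Submodule.iSup_induction' with
  | zero => simp
  | add x y _ _ hx hy =>
    rw [map_add]
    exact add_mem hx hy
  | mem n t ht =>
    cases n with
    | zero =>
      rw [pow_zero] at ht
      obtain ⟨r, rfl⟩ := Submodule.mem_one.1 ht
      simp [projPlus_apply]
    | succ n =>
      have hplus : t ∈ Tplus K A := Submodule.mem_iSup_of_mem n ht
      rwa [projPlus_of_mem hplus]

theorem mem_Tplus_iff {t : TensorAlgebra K A} : t ∈ Tplus K A ↔ algebraMapInv t = 0 := by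
  refine ⟨algebraMapInv_of_mem_Tplus, fun h => ?_⟩
  have := projPlus_mem t
  rwa [projPlus_apply, h, map_zero, sub_zero] at this

theorem cons_mem_Tplus (x : A) (U : TensorAlgebra K A) : cons x U ∈ Tplus K A := by
  simp [mem_Tplus_iff, cons_apply, algebraMapInv]

theorem bat_mem_Tplus {p q : ℕ} (hp : 1 ≤ p) (u : Fin p → HomEl 𝒜) (v : Fin q → HomEl 𝒜) :
    bat a u v ∈ Tplus K A := by
  refine Submodule.sum_mem _ fun σ _ => ?_
  rw [Units.smul_def]
  refine zsmul_mem ?_ _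
  obtain ⟨n, hn⟩ := Nat.exists_eq_add_of_le' (hp.trans (Nat.le_add_right p q))
  rw [letters, List.ofFn_congr hn, List.ofFn_succ]
  exact tens_cons_mem _ _

variable (a 𝒜) in
/-- The quotient map onto `H`, extended by `0` to the scalars, so that it can be applied to all
words, the empty one included. -/
def toH : TensorAlgebra K A →ₗ[K] H a 𝒜 :=
  Submodule.mkQ _ ∘ₗ (projPlus K A).codRestrict (Tplus K A) projPlus_mem

theorem toH_of_mem {t : TensorAlgebra K A} (ht : t ∈ Tplus K A) :
    toH a 𝒜 t = Submodule.Quotient.mk ⟨t, ht⟩ :=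
  congrArg Submodule.Quotient.mk (Subtype.ext (projPlus_of_mem ht))

theorem toH_eq_zero_iff {t : TensorAlgebra K A} : toH a 𝒜 t = 0 ↔ projPlus K A t ∈ shuffles a 𝒜 :=
  Submodule.Quotient.mk_eq_zero _

theorem toH_one : toH a 𝒜 1 = 0 := by
  rw [toH_eq_zero_iff, projPlus_one]
  exact zero_mem _

theorem toH_bat {p q : ℕ} (hp : 1 ≤ p) (hq : 1 ≤ q) (u : Fin p → HomEl 𝒜) (v : Fin q → HomEl 𝒜) :
    toH a 𝒜 (bat a u v) = 0 := by
  rw [toH_eq_zero_iff, projPlus_of_mem (bat_mem_Tplus hp u v)]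
  exact Submodule.subset_span ⟨p, q, u, v, hp, hq, rfl⟩

theorem cls_eq_toH (l : List A) : cls a 𝒜 l = toH a 𝒜 (tens K l) := by
  cases l with
  | nil => rw [cls, tens_nil, toH_one]
  | cons x l => rw [cls, toH_of_mem (tens_cons_mem x l)]

theorem toH_surjective : Function.Surjective (toH a 𝒜) := by
  intro X
  obtain ⟨⟨t, ht⟩, rfl⟩ := Submodule.Quotient.mk_surjective _ X
  exact ⟨t, toH_of_mem ht⟩

theorem ker_toH_le_ker {N : Type*} [AddCommGroup N] [Module K N] {F : TensorAlgebra K A →ₗ[K] N}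
    (hone : F 1 = 0)
    (hbat : ∀ (p q : ℕ) (u : Fin p → HomEl 𝒜) (v : Fin q → HomEl 𝒜), 1 ≤ p → 1 ≤ q →
      F (bat a u v) = 0) :
    LinearMap.ker (toH a 𝒜) ≤ LinearMap.ker F := by
  intro t ht
  have hshuffles : shuffles a 𝒜 ≤ LinearMap.ker F := by
    refine Submodule.span_le.2 ?_
    rintro _ ⟨p, q, u, v, hp, hq, rfl⟩
    exact hbat p q u v hp hq
  have hproj : F (projPlus K A t) = 0 := hshuffles (toH_eq_zero_iff.1 ht)
  rwa [projPlus_apply, map_sub, Algebra.algebraMap_eq_smul_one, map_smul, hone, smul_zero,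
    sub_zero] at hproj

end ToH

section Formulas

theorem koszul_smul {N : Type*} [AddCommGroup N] [Module K N] {n : ℕ} (w : Fin n → HomEl 𝒜)
    (σ : Equiv.Perm (Fin n)) (x : N) : koszul a w σ • x =
      koszulSign (fun i => shiftEl a (w i)) (List.ofFn ⇑σ⁻¹) • x := by
  rw [Units.smul_def, ← Int.cast_smul_eq_zsmul K, koszulSign_ofFn, koszul, Finset.prod_filter]
  push_cast
  rw [← Fintype.prod_prod_type' (f := fun s t => if s < t ∧ σ⁻¹ t < σ⁻¹ s then
    sg K ((shiftEl a (w (σ⁻¹ s))).1 * (shiftEl a (w (σ⁻¹ t))).1) else 1)]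
  congr 1
  refine Fintype.prod_equiv ((Equiv.prodComm _ _).trans (Equiv.prodCongr σ σ)) _ _ ?_
  rintro ⟨i, j⟩
  simp only [Equiv.trans_apply, Equiv.prodComm_apply, Prod.swap, Equiv.prodCongr_apply, Prod.map,
    Equiv.Perm.coe_inv, Equiv.symm_apply_apply, and_comm (a := i < j)]
  split_ifs <;> simp [sg, shiftEl, mul_comm]

variable {p q : ℕ}

theorem pairwise_ofFn_castAdd_append_ofFn_natAdd :
    (List.ofFn (Fin.castAdd q) ++ List.ofFn (Fin.natAdd p)).Pairwise (· < ·) := by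
  rw [← List.ofFn_fin_append, List.pairwise_ofFn]
  intro i j hij
  have hid : Fin.append (Fin.castAdd q) (Fin.natAdd p) = id := Fin.append_castAdd_natAdd (f := id)
  rwa [hid]

variable (u : Fin p → HomEl 𝒜) (v : Fin q → HomEl 𝒜)

theorem word_map_ofFn_castAdd :
    word ((List.ofFn (Fin.castAdd q)).map fun i => shiftEl a (Fin.append u v i)) =
      tens K (letters u) := by
  simp [List.map_ofFn, Function.comp_def, word_ofFn]

theorem wordDeg_map_ofFn_castAdd :
    wordDeg ((List.ofFn (Fin.castAdd q)).map fun i => shiftEl a (Fin.append u v i)) =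
      degWord a u := by
  simp [List.map_ofFn, Function.comp_def, wordDeg_ofFn]

theorem word_map_ofFn_natAdd :
    word ((List.ofFn (Fin.natAdd p)).map fun i => shiftEl a (Fin.append u v i)) =
      tens K (letters v) := by
  simp [List.map_ofFn, Function.comp_def, word_ofFn]

theorem sum_Bat_koszul_smul {N : Type*} [AddCommGroup N] [Module K N]
    (F : List (Fin (p + q)) → N) :
    ∑ σ ∈ Bat p q, koszul a (Fin.append u v) σ • F (List.ofFn ⇑σ⁻¹) =
      shuffleSum (fun i => shiftEl a (Fin.append u v i)) F
        (List.ofFn (Fin.castAdd q)) (List.ofFn (Fin.natAdd p)) := by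
  simp only [koszul_smul]
  exact sum_Bat fun l => koszulSign (fun i => shiftEl a (Fin.append u v i)) l • F l

theorem ellTwo_eq_sum (b : ℤ) (bra : A →ₗ[K] A →ₗ[K] A) : ellTwo a b bra u v =
    ∑ σ ∈ Bat p q, koszul a (Fin.append u v) σ • toH a 𝒜
      (mergeSum (b - a + 1) (fun i => shiftEl a (Fin.append u v i)) (fun i j =>
        if (i : ℕ) < p ∧ p ≤ (j : ℕ) then
          ellA a b bra (Fin.append u v i) (Fin.append u v j) else 0) (List.ofFn ⇑σ⁻¹)) := by
  refine Finset.sum_congr rfl fun σ _ => ?_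
  rw [← sum_splice_two, map_sum, Finset.smul_sum, ← Finset.filter_filter, Finset.sum_filter]
  refine Finset.sum_congr rfl fun k _ => ?_
  split_ifs with hk
  · rw [cls_eq_toH, mul_smul, negOnePow_smul_eq_sg_smul (K := K), ← map_smul,
      ← negOnePow_smul_eq_sg_smul]
    rfl
  · rw [splice, tens_zero_letter, smul_zero, map_zero, smul_zero]

namespace HomogeneousBasis

variable {I : Type*} (B : HomogeneousBasis (shift (1 - a) 𝒜) I)

theorem bat_eq_shuffle : bat a u v = B.shuffle (tens K (letters u)) (tens K (letters v)) := by
  have hshuffle := B.shuffleSum_word (w := fun i => shiftEl a (Fin.append u v i))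
    (pairwise_ofFn_castAdd_append_ofFn_natAdd (p := p) (q := q))
  rw [word_map_ofFn_castAdd, word_map_ofFn_natAdd, ← sum_Bat_koszul_smul] at hshuffle
  rw [← hshuffle, bat]
  refine Finset.sum_congr rfl fun σ _ => ?_
  rw [List.map_ofFn]
  exact congrArg _ (word_ofFn a _).symm

theorem ellTwo_eq_bracket (b : ℤ) (bra : A →ₗ[K] A →ₗ[K] A) : ellTwo a b bra u v =
    toH a 𝒜 (sg K ((b - a + 1) * degWord a u) •
      B.bracket (b - a + 1) bra (tens K (letters u)) (tens K (letters v))) := by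
  rw [ellTwo_eq_sum, sum_Bat_koszul_smul u v fun l => toH a 𝒜 (mergeSum _ _ _ l), shuffleSum_map,
    B.shuffleSum_mergeSum (bra := bra), word_map_ofFn_castAdd, word_map_ofFn_natAdd,
    wordDeg_map_ofFn_castAdd]
  · intro i _ k hk
    obtain ⟨k, rfl⟩ := List.mem_ofFn.1 hk
    simp
  · intro j hj i
    obtain ⟨j, rfl⟩ := List.mem_ofFn.1 hj
    simp
  · intro i hi j hj
    obtain ⟨i, rfl⟩ := List.mem_ofFn.1 hi
    obtain ⟨j, rfl⟩ := List.mem_ofFn.1 hj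
    simp [ellA, shiftEl, negOnePow_smul_eq_sg_smul (K := K)]
  · exact pairwise_ofFn_castAdd_append_ofFn_natAdd

theorem dOne_add_muOne_eq_diff (mul : A →ₗ[K] A →ₗ[K] A) (d : A →ₗ[K] A) {n : ℕ}
    (w : Fin n → HomEl 𝒜) :
    dOne a d w + muOne a mul w = toH a 𝒜 (B.diff mul d (tens K (letters w))) := by
  have hdiff := B.diff_word (mul := mul) (d := d) (fun i => shiftEl a (w i)) (List.ofFn id)
  rw [← sum_splice_two] at hdiff
  simp only [List.map_ofFn, Function.comp_def, id_eq, word_ofFn, ← sum_splice_one, one_mul,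
    negOnePow_smul_eq_sg_smul (K := K)] at hdiff
  rw [hdiff, map_add, map_sum, map_sum]
  simp only [dOne, muOne, cls_eq_toH, map_smul, negOnePow_smul_eq_sg_smul (K := K), muA]
  rfl

end HomogeneousBasis

end Formulas

/-! ### Differential graded Lie algebras -/

section Shift

variable {V : Type*} [AddCommGroup V] [Module K V] {𝒱 : ℤ → Submodule K V}

theorem isInternal_shift (h : DirectSum.IsInternal 𝒱) (k : ℤ) :
    DirectSum.IsInternal (shift k 𝒱) := by
  rw [DirectSum.isInternal_submodule_iff_iSupIndep_and_iSup_eq_top] at h ⊢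
  exact ⟨h.1.comp (add_left_injective k), ((Equiv.addRight k).iSup_comp (g := 𝒱)).trans h.2⟩

theorem isInternal_of_exists_scale (hsup : ⨆ x, 𝒱 x = ⊤)
    (hscale : ∀ χ : ℤ → K, ∃ G : V →ₗ[K] V, ∀ x, ∀ X ∈ 𝒱 x, G X = χ x • X) :
    DirectSum.IsInternal 𝒱 := by
  rw [DirectSum.isInternal_submodule_iff_iSupIndep_and_iSup_eq_top]
  refine ⟨fun x => ?_, hsup⟩
  obtain ⟨G, hG⟩ := hscale (Pi.single x 1)
  rw [Submodule.disjoint_def]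
  intro X hX hX'
  have hfix : G X = X := by rw [hG x X hX, Pi.single_eq_same, one_smul]
  have hker : ⨆ y, ⨆ (_ : y ≠ x), 𝒱 y ≤ LinearMap.ker G := by
    refine iSup₂_le fun y hy Y hY => ?_
    rw [LinearMap.mem_ker, hG y Y hY, Pi.single_eq_of_ne hy, zero_smul]
  rw [← hfix]
  exact hker hX'

theorem IsDGLieAlgebra.map {W : Type*} [AddCommGroup W] [Module K W] {br : V →ₗ[K] V →ₗ[K] V}
    {D : V →ₗ[K] V} {br' : W →ₗ[K] W →ₗ[K] W} {D' : W →ₗ[K] W} {f : V →ₗ[K] W}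
    (h : IsDGLieAlgebra 𝒱 br D) (hf : Function.Surjective f)
    (hbr : ∀ X Y, br' (f X) (f Y) = f (br X Y)) (hD : ∀ X, D' (f X) = f (D X))
    (hinternal : DirectSum.IsInternal fun x => (𝒱 x).map f) :
    IsDGLieAlgebra (fun x => (𝒱 x).map f) br' D' where
  isInternal := hinternal
  br_mem := by
    rintro x y _ _ ⟨X, hX, rfl⟩ ⟨Y, hY, rfl⟩
    exact ⟨_, h.br_mem hX hY, (hbr X Y).symm⟩
  D_mem := by
    rintro x _ ⟨X, hX, rfl⟩
    exact ⟨_, h.D_mem hX, (hD X).symm⟩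
  antisymm := by
    rintro x y _ _ ⟨X, hX, rfl⟩ ⟨Y, hY, rfl⟩
    rw [hbr, hbr, h.antisymm hX hY, map_neg, negOnePow_smul_eq_sg_smul (K := K), map_smul,
      negOnePow_smul_eq_sg_smul (K := K)]
  jacobi := by
    rintro x y z _ _ _ ⟨X, hX, rfl⟩ ⟨Y, hY, rfl⟩ ⟨Z, hZ, rfl⟩
    simpa only [hbr, negOnePow_smul_eq_sg_smul (K := K), map_add, map_smul, map_zero] using
      congrArg f (h.jacobi hX hY hZ)
  D_br := by
    rintro x y _ _ ⟨X, hX, rfl⟩ ⟨Y, hY, rfl⟩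
    simpa only [hbr, hD, negOnePow_smul_eq_sg_smul (K := K), map_add, map_smul] using
      congrArg f (h.D_br hX hY)
  D_D Y := by
    obtain ⟨X, rfl⟩ := hf Y
    rw [hD, hD, h.D_D, map_zero]

namespace IsDGABAlgebra

variable {b : ℤ} {mul bra : V →ₗ[K] V →ₗ[K] V} {d : V →ₗ[K] V}

theorem shift (h : IsDGABAlgebra a b 𝒱 mul bra d) (k : ℤ) :
    IsDGABAlgebra (a + k) (b + k) (shift k 𝒱) mul bra d where
  isInternal := isInternal_shift h.isInternal k
  mul_mem hX hY := by
    rw [ABHomotopy.shift]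
    convert h.mul_mem hX hY using 2
    ring
  bra_mem hX hY := by
    rw [ABHomotopy.shift]
    convert h.bra_mem hX hY using 2
    ring
  d_mem hX := by
    rw [ABHomotopy.shift]
    convert h.d_mem hX using 2
    ring
  mul_comm hX hY := by
    convert h.mul_comm hX hY using 4 <;> ring
  mul_assoc := h.mul_assoc
  bra_antisymm hX hY := by
    convert h.bra_antisymm hX hY using 5 <;> ring
  jacobi hX hY hZ := by
    simpa only [← add_assoc, add_right_comm _ b k] using h.jacobi hX hY hZ
  leibniz hX hY hZ := by
    simpa only [← add_assoc, add_right_comm _ b k, add_right_comm _ a k] using h.leibniz hX hY hZ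
  d_d := h.d_d
  d_mul hX hY := by
    simpa only [← add_assoc, add_right_comm _ a k] using h.d_mul hX hY
  d_bra hX hY := by
    simpa only [← add_assoc, add_right_comm _ b k] using h.d_bra hX hY

theorem isDGLieAlgebra (h : IsDGABAlgebra a 0 𝒱 mul bra d) (r : K) :
    IsDGLieAlgebra 𝒱 (r • bra) d where
  isInternal := h.isInternal
  br_mem hX hY := Submodule.smul_mem _ r (by simpa only [add_zero] using h.bra_mem hX hY)
  D_mem := h.d_mem
  antisymm {x y X Y} hX hY := by
    have hswap := h.bra_antisymm hX hY
    simp only [add_zero, negOnePow_smul_eq_sg_smul (K := K)] at hswap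
    simp only [LinearMap.smul_apply, hswap, negOnePow_smul_eq_sg_smul (K := K)]
    module
  jacobi {x y z X Y Z} hX hY hZ := by
    have hjacobi := congrArg ((r * r) • ·) (h.jacobi hX hY hZ)
    simp only [add_zero, negOnePow_smul_eq_sg_smul (K := K), smul_zero] at hjacobi
    simp only [LinearMap.smul_apply, map_smul, negOnePow_smul_eq_sg_smul (K := K)]
    rw [← hjacobi]
    module
  D_br {x y X Y} hX hY := by
    have hbra := h.d_bra hX hY
    simp only [add_zero, negOnePow_smul_eq_sg_smul (K := K)] at hbra
    simp only [LinearMap.smul_apply, map_smul, hbra, negOnePow_smul_eq_sg_smul (K := K)]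
    module
  D_D := h.d_d

end IsDGABAlgebra

end Shift

namespace HomogeneousBasis

variable {I : Type*} (B : HomogeneousBasis ℬ I)

include B in
theorem exists_scale (χ : ℤ → K) : ∃ G : TensorAlgebra K A →ₗ[K] TensorAlgebra K A,
    ∀ m, ∀ U ∈ gradT ℬ m, G U = χ m • U := by
  refine ⟨B.wordBasis.constr K fun u => χ (B.indexDeg u) • B.wordBasis u, fun m U hU => ?_⟩
  rw [← B.span_wordBasis] at hU
  refine LinearMap.eqOn_span (g := χ m • LinearMap.id) ?_ hU
  rintro _ ⟨u, rfl, rfl⟩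
  rw [Module.Basis.constr_basis]
  rfl

include B in
theorem iSup_gradT : ⨆ m, gradT ℬ m = ⊤ := by
  rw [eq_top_iff, ← B.wordBasis.span_eq, Submodule.span_le]
  rintro _ ⟨u, rfl⟩
  exact Submodule.mem_iSup_of_mem _ (B.wordBasis_mem u)

variable {c m n p : ℤ} {U V W : TensorAlgebra K A} {mul bra : A →ₗ[K] A →ₗ[K] A} {d : A →ₗ[K] A}

theorem bracket_jacobi (h : IsDGABAlgebra 1 c ℬ mul bra d) (hU : U ∈ gradT ℬ m)
    (hV : V ∈ gradT ℬ n) (hW : W ∈ gradT ℬ p) :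
    sg K ((m + c) * (p + c)) • B.bracket c bra (B.bracket c bra U V) W +
      sg K ((n + c) * (m + c)) • B.bracket c bra (B.bracket c bra V W) U +
      sg K ((p + c) * (n + c)) • B.bracket c bra (B.bracket c bra W U) V = 0 := by
  rw [B.bracket_swap h (B.bracket_mem h hV hW) hU, B.bracket_swap h (B.bracket_mem h hW hU) hV,
    B.bracket_swap h hW hU, B.bracket_bracket h hU hV hW]
  simp only [map_smul, mul_add, sg_add, sg_mul_self, mul_comm]
  match_scalars <;> ring_nf <;> simp [sg_pow]

theorem isDGABAlgebra_tensorAlgebra (h : IsDGABAlgebra 1 c ℬ mul bra d) :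
    IsDGABAlgebra 0 c (gradT ℬ) B.shuffle (B.bracket c bra) (B.diff mul d) where
  isInternal := isInternal_of_exists_scale B.iSup_gradT B.exists_scale
  mul_mem hU hV := by
    rw [add_zero]
    exact B.shuffle_mem hU hV
  bra_mem := B.bracket_mem h
  d_mem := B.diff_mem h
  mul_comm hU hV := by
    simpa only [add_zero, negOnePow_smul_eq_sg_smul (K := K)] using B.shuffle_comm hU hV
  mul_assoc U V W := (B.shuffle_assoc U V W).symm
  bra_antisymm hU hV := by
    rw [B.bracket_swap h hU hV, negOnePow_smul_eq_sg_smul (K := K), neg_smul]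
  jacobi hU hV hW := by
    simpa only [negOnePow_smul_eq_sg_smul (K := K)] using B.bracket_jacobi h hU hV hW
  leibniz hU hV hW := by
    simpa only [add_zero, negOnePow_smul_eq_sg_smul (K := K)] using B.bracket_shuffle h hU hV hW
  d_d := LinearMap.congr_fun (f := B.diff mul d ∘ₗ B.diff mul d) (g := 0)
    (B.wordBasis.ext fun u => B.diff_diff h (B.wordBasis_mem u))
  d_mul hU hV := by
    simpa only [add_zero, negOnePow_smul_eq_sg_smul (K := K)] using B.diff_shuffle h hU hV
  d_bra hU hV := by
    simpa only [negOnePow_smul_eq_sg_smul (K := K)] using B.diff_bracket h hU hV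

end HomogeneousBasis

section Letters

variable {n : ℕ}

theorem tens_letters_mem (a : ℤ) (w : Fin n → HomEl 𝒜) :
    tens K (letters w) ∈ gradT (shift (1 - a) 𝒜) (degWord a w) := by
  rw [← word_ofFn a, ← wordDeg_ofFn]
  exact word_mem _

theorem tens_letters_mem_Tplus (hn : 1 ≤ n) (w : Fin n → HomEl 𝒜) :
    tens K (letters w) ∈ Tplus K A := by
  obtain ⟨n, rfl⟩ := Nat.exists_eq_add_of_le' hn
  rw [letters, List.ofFn_succ]
  exact tens_cons_mem _ _

theorem exists_word_eq_tens_letters (u : List (HomEl (shift (1 - a) 𝒜))) :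
    ∃ w : Fin u.length → HomEl 𝒜, word u = tens K (letters w) ∧ wordDeg u = degWord a w := by
  have hsurj (x : HomEl (shift (1 - a) 𝒜)) : ∃ y : HomEl 𝒜, shiftEl a y = x := by
    obtain ⟨i, x⟩ := x
    have hdg : i + (1 - a) + a - 1 = i := by ring
    exact ⟨⟨i + (1 - a), x.1, x.2⟩, Sigma.subtype_ext hdg rfl⟩
  choose w hw using fun i => hsurj (u.get i)
  have hu : u = List.ofFn fun i => shiftEl a (w i) := by simp [hw]
  exact ⟨w, (congrArg word hu).trans (word_ofFn a w),
    (congrArg wordDeg hu).trans (wordDeg_ofFn a w)⟩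

end Letters

theorem gradH_eq_map (x : ℤ) :
    gradH a 𝒜 x = (gradT (shift (1 - a) 𝒜) x).map (toH a 𝒜) := by
  apply le_antisymm
  · refine Submodule.span_le.2 ?_
    rintro _ ⟨n, w, _, rfl, rfl⟩
    exact ⟨_, tens_letters_mem a w, (cls_eq_toH _).symm⟩
  · rw [gradT, Submodule.map_span_le]
    rintro _ ⟨u, rfl, rfl⟩
    rcases u with _ | ⟨x, u⟩
    · rw [word_nil, toH_one]
      exact zero_mem _
    · obtain ⟨w, hw, hdeg⟩ := exists_word_eq_tens_letters (x :: u)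
      rw [hw, hdeg]
      exact Submodule.subset_span ⟨_, w, by simp, rfl, (cls_eq_toH _).symm⟩

namespace HomogeneousBasis

section Augmentation

variable {I : Type*} (B : HomogeneousBasis ℬ I)

theorem bracket_mem_Tplus (c : ℤ) (bra : A →ₗ[K] A →ₗ[K] A) (U V : TensorAlgebra K A) :
    B.bracket c bra U V ∈ Tplus K A := by
  have h : (B.bracket c bra).compr₂ TensorAlgebra.algebraMapInv.toLinearMap = 0 := by
    refine B.wordBasis.ext fun u => B.wordBasis.ext fun v => mem_Tplus_iff.1 ?_
    rcases u with _ | ⟨i, u⟩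
    · simp
    rcases v with _ | ⟨j, v⟩
    · simp
    rw [wordBasis_cons, wordBasis_cons,
      B.bracket_cons_cons (B.letter_mem i) (B.wordBasis_mem u) (B.letter_mem j)]
    exact add_mem (add_mem (cons_mem_Tplus _ _) (Submodule.smul_mem _ _ (cons_mem_Tplus _ _)))
      (Submodule.smul_mem _ _ (cons_mem_Tplus _ _))
  exact mem_Tplus_iff.2 (LinearMap.congr_fun₂ h U V)

theorem diff_mem_Tplus (mul : A →ₗ[K] A →ₗ[K] A) (d : A →ₗ[K] A) (U : TensorAlgebra K A) :
    B.diff mul d U ∈ Tplus K A := by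
  have h : TensorAlgebra.algebraMapInv.toLinearMap ∘ₗ B.diff mul d = 0 := by
    refine B.wordBasis.ext fun u => mem_Tplus_iff.1 ?_
    rcases u with _ | ⟨i, _ | ⟨j, u⟩⟩
    · simp
    · rw [wordBasis_cons, wordBasis_nil, B.diff_cons (B.letter_mem i), absorb_one]
      exact add_mem (cons_mem_Tplus _ _)
        (Submodule.smul_mem _ _ (add_mem (cons_mem_Tplus _ _) (zero_mem _)))
    · rw [wordBasis_cons, B.diff_cons (B.letter_mem i), wordBasis_cons, absorb_cons]
      exact add_mem (cons_mem_Tplus _ _)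
        (Submodule.smul_mem _ _ (add_mem (cons_mem_Tplus _ _) (cons_mem_Tplus _ _)))
  exact mem_Tplus_iff.2 (LinearMap.congr_fun h U)

end Augmentation

section Quotient

variable {I : Type*} (B : HomogeneousBasis (shift (1 - a) 𝒜) I)

theorem toH_shuffle_word {u v : List (HomEl (shift (1 - a) 𝒜))} (hu : u ≠ []) (hv : v ≠ []) :
    toH a 𝒜 (B.shuffle (word u) (word v)) = 0 := by
  obtain ⟨w, hw, -⟩ := exists_word_eq_tens_letters u
  obtain ⟨w', hw', -⟩ := exists_word_eq_tens_letters v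
  rw [hw, hw', ← B.bat_eq_shuffle]
  exact toH_bat (List.length_pos_iff.2 hu) (List.length_pos_iff.2 hv) w w'

theorem toH_shuffle {U V : TensorAlgebra K A} (hU : U ∈ Tplus K A) (hV : V ∈ Tplus K A) :
    toH a 𝒜 (B.shuffle U V) = 0 := by
  have h : (B.shuffle.compl₁₂ (projPlus K A) (projPlus K A)).compr₂ (toH a 𝒜) = 0 := by
    refine B.wordBasis.ext fun u => B.wordBasis.ext fun v => ?_
    rw [LinearMap.compr₂_apply, LinearMap.compl₁₂_apply]
    rcases u with _ | ⟨i, u⟩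
    · simp [projPlus_one]
    rcases v with _ | ⟨j, v⟩
    · simp [projPlus_one]
    rw [wordBasis_cons, wordBasis_cons, projPlus_of_mem (cons_mem_Tplus _ _),
      projPlus_of_mem (cons_mem_Tplus _ _), ← wordBasis_cons, ← wordBasis_cons, wordBasis_eq_word,
      wordBasis_eq_word]
    exact B.toH_shuffle_word (by simp) (by simp)
  rw [← projPlus_of_mem hU, ← projPlus_of_mem hV]
  exact LinearMap.congr_fun₂ h U V

theorem ker_toH_le_ker_of_shuffle {N : Type*} [AddCommGroup N] [Module K N]
    {F : TensorAlgebra K A →ₗ[K] N} (hone : F 1 = 0)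
    (hshuffle : ∀ {m n U V}, U ∈ gradT (shift (1 - a) 𝒜) m → V ∈ gradT (shift (1 - a) 𝒜) n →
      U ∈ Tplus K A → V ∈ Tplus K A → F (B.shuffle U V) = 0) :
    LinearMap.ker (toH a 𝒜) ≤ LinearMap.ker F := by
  refine ker_toH_le_ker hone fun p q u v hp hq => ?_
  rw [B.bat_eq_shuffle]
  exact hshuffle (tens_letters_mem a u) (tens_letters_mem a v) (tens_letters_mem_Tplus hp u)
    (tens_letters_mem_Tplus hq v)

include B in
theorem exists_scaleH (χ : ℤ → K) : ∃ G : H a 𝒜 →ₗ[K] H a 𝒜,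
    ∀ x, ∀ X ∈ gradH a 𝒜 x, G X = χ x • X := by
  obtain ⟨G, hG⟩ := B.exists_scale χ
  obtain ⟨GH, hGH⟩ := exists_factor toH_surjective (toH a 𝒜 ∘ₗ G) <|
    B.ker_toH_le_ker_of_shuffle
      (by rw [LinearMap.comp_apply, hG 0 1 one_mem_gradT, map_smul, toH_one, smul_zero])
      fun hU hV hU' hV' => by
        rw [LinearMap.comp_apply, hG _ _ (B.shuffle_mem hU hV), map_smul, B.toH_shuffle hU' hV',
          smul_zero]
  refine ⟨GH, fun x X hX => ?_⟩
  rw [gradH_eq_map] at hX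
  obtain ⟨U, hU, rfl⟩ := hX
  rw [hGH, LinearMap.comp_apply, hG x U hU, map_smul]

include B in
theorem isInternal_gradH : DirectSum.IsInternal (gradH a 𝒜) := by
  refine isInternal_of_exists_scale ?_ B.exists_scaleH
  simp only [gradH_eq_map]
  rw [← Submodule.map_iSup, B.iSup_gradT, Submodule.map_top,
    LinearMap.range_eq_top.2 toH_surjective]

variable {c : ℤ} {mul bra : A →ₗ[K] A →ₗ[K] A} {d : A →ₗ[K] A}

theorem exists_diffH (h : IsDGABAlgebra 1 c (shift (1 - a) 𝒜) mul bra d) :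
    ∃ D : H a 𝒜 →ₗ[K] H a 𝒜, ∀ U, D (toH a 𝒜 U) = toH a 𝒜 (B.diff mul d U) := by
  refine exists_factor toH_surjective (toH a 𝒜 ∘ₗ B.diff mul d) <|
    B.ker_toH_le_ker_of_shuffle (by simp) fun hU hV hU' hV' => ?_
  rw [LinearMap.comp_apply, B.diff_shuffle h hU hV, map_add, map_smul,
    B.toH_shuffle (B.diff_mem_Tplus mul d _) hV', B.toH_shuffle hU' (B.diff_mem_Tplus mul d _),
    smul_zero, add_zero]

theorem exists_bracketH (h : IsDGABAlgebra 1 c (shift (1 - a) 𝒜) mul bra d) :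
    ∃ P : H a 𝒜 →ₗ[K] H a 𝒜 →ₗ[K] H a 𝒜,
      ∀ U V, P (toH a 𝒜 U) (toH a 𝒜 V) = toH a 𝒜 (B.bracket c bra U V) := by
  refine exists_factor₂ toH_surjective ((B.bracket c bra).compr₂ (toH a 𝒜)) ?_ ?_
  · refine B.ker_toH_le_ker_of_shuffle (by ext; simp) fun hU hV hU' hV' => ?_
    refine B.wordBasis.ext fun w => ?_
    rw [LinearMap.compr₂_apply, B.shuffle_bracket h hU hV (B.wordBasis_mem w), map_add, map_smul,
      B.toH_shuffle hU' (B.bracket_mem_Tplus c bra _ _),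
      B.toH_shuffle (B.bracket_mem_Tplus c bra _ _) hV', smul_zero, add_zero]
    rfl
  · refine B.ker_toH_le_ker_of_shuffle (by ext; simp) fun hU hV hU' hV' => ?_
    refine B.wordBasis.ext fun w => ?_
    rw [LinearMap.flip_apply, LinearMap.compr₂_apply, B.bracket_shuffle h (B.wordBasis_mem w) hU hV,
      map_add, map_smul, B.toH_shuffle (B.bracket_mem_Tplus c bra _ _) hV',
      B.toH_shuffle hU' (B.bracket_mem_Tplus c bra _ _), smul_zero, add_zero]
    rfl

theorem isDGLieAlgebra_gradH (h : IsDGABAlgebra 1 c (shift (1 - a) 𝒜) mul bra d) {k : ℤ}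
    (hk : c + k = 0) (r : K) {P : H a 𝒜 →ₗ[K] H a 𝒜 →ₗ[K] H a 𝒜} {D : H a 𝒜 →ₗ[K] H a 𝒜}
    (hP : ∀ U V, P (toH a 𝒜 U) (toH a 𝒜 V) = toH a 𝒜 (B.bracket c bra U V))
    (hD : ∀ U, D (toH a 𝒜 U) = toH a 𝒜 (B.diff mul d U)) :
    IsDGLieAlgebra (shift k (gradH a 𝒜)) (r • P) D := by
  have htensor := (B.isDGABAlgebra_tensorAlgebra h).shift k
  rw [hk] at htensor
  have hgrad : shift k (gradH a 𝒜) =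
      fun x => (shift k (gradT (shift (1 - a) 𝒜)) x).map (toH a 𝒜) :=
    funext fun x => gradH_eq_map (x + k)
  have hinternal := isInternal_shift B.isInternal_gradH k
  rw [hgrad] at hinternal ⊢
  refine (htensor.isDGLieAlgebra r).map toH_surjective (fun U V => ?_) hD hinternal
  rw [LinearMap.smul_apply, LinearMap.smul_apply, hP, LinearMap.smul_apply, LinearMap.smul_apply,
    map_smul]

end Quotient

end HomogeneousBasis

end ABHomotopy

open ABHomotopy in
theorem proposition4p2 {K : Type*} [Field K] {A : Type*} [AddCommGroup A] [Module K A]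
    (a b : ℤ) (𝒜 : ℤ → Submodule K A) (mul bra : A →ₗ[K] A →ₗ[K] A) (d : A →ₗ[K] A)
    (hA : ABHomotopy.IsDGABAlgebra a b 𝒜 mul bra d) :
    ∃ (l₂ : ABHomotopy.H a 𝒜 →ₗ[K] ABHomotopy.H a 𝒜 →ₗ[K] ABHomotopy.H a 𝒜)
      (D : ABHomotopy.H a 𝒜 →ₗ[K] ABHomotopy.H a 𝒜)
      (l₂' : ABHomotopy.H a 𝒜 →ₗ[K] ABHomotopy.H a 𝒜 →ₗ[K] ABHomotopy.H a 𝒜),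
      -- `l₂` and `D = d₁ + μ₁` are given by their formulas on classes of words
      (∀ (p q : ℕ) (u : Fin p → ABHomotopy.HomEl 𝒜) (v : Fin q → ABHomotopy.HomEl 𝒜),
        1 ≤ p → 1 ≤ q →
        l₂ (ABHomotopy.cls a 𝒜 (ABHomotopy.letters u)) (ABHomotopy.cls a 𝒜 (ABHomotopy.letters v))
          = ABHomotopy.ellTwo a b bra u v) ∧
      (∀ (n : ℕ) (w : Fin n → ABHomotopy.HomEl 𝒜), 1 ≤ n →
        D (ABHomotopy.cls a 𝒜 (ABHomotopy.letters w))
          = ABHomotopy.dOne a d w + ABHomotopy.muOne a mul w) ∧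
      -- `l₂'(X, Y) = (-1)^{(a-b-1) x'} l₂(X, Y)`, where `x'` is the degree of `X` in `H[a-b-1]`
      (∀ (x' : ℤ) (X Y : ABHomotopy.H a 𝒜),
        X ∈ ABHomotopy.shift (a - b - 1) (ABHomotopy.gradH a 𝒜) x' →
        l₂' X Y = ((a - b - 1) * x').negOnePow • l₂ X Y) ∧
      ABHomotopy.IsDGLieAlgebra (ABHomotopy.shift (a - b - 1) (ABHomotopy.gradH a 𝒜)) l₂' D := by
  have h : IsDGABAlgebra 1 (b - a + 1) (shift (1 - a) 𝒜) mul bra d := by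
    convert hA.shift (1 - a) using 1 <;> ring
  let B := HomogeneousBasis.ofIsInternal h.isInternal
  obtain ⟨D, hD⟩ := B.exists_diffH h
  obtain ⟨P, hP⟩ := B.exists_bracketH h
  obtain ⟨G, hG⟩ := B.exists_scaleH fun x => sg K ((b - a + 1) * x)
  refine ⟨P ∘ₗ G, D, sg K (b - a + 1) • P, fun p q u v _ _ => ?_, fun n w _ => ?_,
    fun x X Y hX => ?_, B.isDGLieAlgebra_gradH h (by ring) _ hP hD⟩
  · have hu : cls a 𝒜 (letters u) ∈ gradH a 𝒜 (degWord a u) := by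
      rw [cls_eq_toH, gradH_eq_map]
      exact Submodule.mem_map_of_mem (tens_letters_mem a u)
    rw [LinearMap.comp_apply, hG _ _ hu, map_smul, LinearMap.smul_apply, cls_eq_toH, cls_eq_toH,
      hP, B.ellTwo_eq_bracket, map_smul]
  · rw [cls_eq_toH, hD, B.dOne_add_muOne_eq_diff]
  · have hsign : (a - b - 1) * x + (b - a + 1) * (x + (a - b - 1)) =
        -((b - a + 1) * (b - a + 1)) := by ring
    simp only [LinearMap.comp_apply, hG _ X hX, map_smul, LinearMap.smul_apply,
      negOnePow_smul_eq_sg_smul (K := K), smul_smul, ← sg_add]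
    rw [hsign, sg_neg, sg_mul_self]
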